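/- Let $X_1,\dots,X_n$ be i.i.d. nonnegative random variables with unknown density $f_X$, and let $\eta_1,\dots,\eta_n$ be i.i.d. nonnegative random variables, independent of the $X_i$, with known density $g$. One observes $Y_i=X_i\eta_i$, $i=1,\dots,n$. **Class of densities.** For $\beta,r,A,M>0$ put $\ell:=\max\{k\in\mathbb N_0:k<\beta\}$. The class $\bar{\mathscr H}_r(A,\beta,M)$ consists of all probability densities $f$ on $[0,\infty)$ that are $\ell$ times continuously differentiable on $(0,r]$, with $|f^{(k)}(x)|\le A$ for $1\le k\le \ell$ and $|f^{(\ell)}(x)-f^{(\ell)}(x')|\le A|x-x'|^{\beta-\ell}$ for all $x,x'\in(0,r]$, with $\sup_{t\ge 0}|f(t)|\le M$, and with $f(0)=\lim_{x\downarrow 0}f(x)$. **Minimax risk.** For a class $\Sigma$ of densities, $$\mathcal R_n^*[\Sigma]:=\inf_{\hat f}\ \sup_{f_X\in\Sigma}\Big[\mathbb E_{f_X}|\hat f-f_X(0)|^2\Big]^{1/2},$$ where the infimum is over all estimators, i.e. measurable functions $\hat f=\hat f(Y_1,\dots,Y_n)$. **Assumptions on $g$.** Let $\tilde g(z):=\int_0^\infty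 x^{z-1}g(x)\,dx$ be the Mellin transform of $g$. * [G3] For some $p\in[0,1)$, $q\ge 0$, $\delta\in(0,1)$ and positive constants $c_0,C_0$, $$c_0x^{-p}[\ln(1/x)]^q\le g(x)\le C_0x^{-p}[\ln(1/x)]^q,\qquad x\in(0,\delta).$$ * [G5] For some $\epsilon>0$ the integral defining $\tilde g(z)$ converges absolutely whenever $1\le \operatorname{Re} z\le 1+\epsilon$, and $|\tilde g(1+\epsilon+i\omega)|\le C_4<\infty$ for all $\omega\in\mathbb R$. Put $\kappa:=1$ if $p=0$, $\kappa:=0$ if $p\in(0,1)$, and $$\phi_n:=A^{\frac{p+1}{2\beta+1+p}}\Big[M^{1-p}(\ln n)^{q+\kappa}n^{-1}\Big]^{\frac{\beta}{2\beta+1+p}}.$$ **Theorem.** Let $\beta>0$. There is a constant $K>0$ depending only on $\beta$ such that the following holds for all values of the parameters $p,q,\delta,c_0,C_0,\epsilon,C_4$. 1. There is a constant $C_5>0$, depending only on $\beta$ and on these parameters, such that for every density $g$ that satisfies [G3] and [G5] with these parameters, all $r>0$, all $M\ge1$ and all sufficiently large $A$, namely all $A\ge KM^{\beta+1}$, $$\liminf_{n\to\infty}\Big\{\phi_n^{-1}\,\mathcal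 R_n^*[\bar{\mathscr H}_r(A,\beta,M)]\Big\}\ \ge\ C_5 .$$ 2. For arbitrary $r>0$, $A>0$ and $M\ge 1$ the same inequality holds, for every density $g$ that satisfies [G3] and [G5] with these parameters, with $C_5$ replaced by a constant $C>0$ that may depend on $r$, $A$ and $M$ in addition to $\beta$ and these parameters. -/

import Mathlib

open Set Filter MeasureTheory

noncomputable section

/-- `f` is (a version of) a probability density of a nonnegative random variable. -/
structure IsNonnegDensity (f : ℝ → ℝ) : Prop where
  measurable : Measurable f
  nonneg : ∀ x, 0 ≤ f x
  eq_zero_of_neg : ∀ x, x < 0 → f x = 0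
  lintegral_eq_one : ∫⁻ x, ENNReal.ofReal (f x) = 1

/-- The probability law with density `f`. -/
def densityLaw (f : ℝ → ℝ) : Measure ℝ :=
  volume.withDensity fun x => ENNReal.ofReal (f x)

/-- The law of one observation `Y = X * η`, where `X` and `η` are independent with densities
`f` and `g`. -/
def obsLaw (f g : ℝ → ℝ) : Measure ℝ :=
  ((densityLaw f).prod (densityLaw g)).map fun z => z.1 * z.2

theorem isProbabilityMeasure_densityLaw {f : ℝ → ℝ} (hf : IsNonnegDensity f) :
    IsProbabilityMeasure (densityLaw f) :=
  ⟨by simpa [densityLaw] using hf.lintegral_eq_one⟩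

instance sFinite_densityLaw (f : ℝ → ℝ) : SFinite (densityLaw f) := by
  unfold densityLaw; infer_instance

theorem isProbabilityMeasure_obsLaw {f g : ℝ → ℝ} (hf : IsNonnegDensity f)
    (hg : IsNonnegDensity g) : IsProbabilityMeasure (obsLaw f g) := by
  have := isProbabilityMeasure_densityLaw hf
  have := isProbabilityMeasure_densityLaw hg
  exact Measure.isProbabilityMeasure_map (by fun_prop)

/-- The law of an i.i.d. sample `Y₁, …, Yₙ` from `μ`.  It is defined for every measure `μ`
and is the usual product measure when `μ` is a probability measure. -/
def sampleLaw (n : ℕ) (μ : Measure ℝ) : Measure (Fin n → ℝ) :=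
  Measure.pi fun _ => μ

/-- The largest nonnegative integer that is strictly smaller than `β` (for `β > 0`). -/
def holderOrder (β : ℝ) : ℕ := ⌈β⌉₊ - 1

theorem isGreatest_holderOrder {β : ℝ} (hβ : 0 < β) :
    IsGreatest {k : ℕ | (k : ℝ) < β} (holderOrder β) := by
  have h1 : 0 < ⌈β⌉₊ := Nat.ceil_pos.2 hβ
  refine ⟨?_, fun k hk => ?_⟩
  · have h2 : holderOrder β < ⌈β⌉₊ := by unfold holderOrder; omega
    exact Nat.lt_ceil.1 h2
  · have := Nat.lt_ceil.2 (show (k : ℝ) < β from hk)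
    unfold holderOrder; omega

/-- The class of densities `f` on `[0, ∞)` that are locally Hölder smooth to the right of the
origin and bounded by `M`.  The value `f 0` is the right limit `f (0+)`, so that the quantity to be
estimated does not depend on the choice of a version of the density. -/
structure HolderClass (r A β M : ℝ) (f : ℝ → ℝ) : Prop where
  density : IsNonnegDensity f
  right_continuous : Tendsto f (nhdsWithin 0 (Ioi 0)) (nhds (f 0))
  contDiffOn : ContDiffOn ℝ (holderOrder β) f (Ioc 0 r)
  deriv_le : ∀ k : ℕ, 1 ≤ k → k ≤ holderOrder β → ∀ x ∈ Ioc 0 r,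
    |iteratedDerivWithin k f (Ioc 0 r) x| ≤ A
  holder : ∀ x ∈ Ioc 0 r, ∀ x' ∈ Ioc 0 r,
    |iteratedDerivWithin (holderOrder β) f (Ioc 0 r) x -
      iteratedDerivWithin (holderOrder β) f (Ioc 0 r) x'| ≤ A * |x - x'| ^ (β - holderOrder β)
  bounded : ∀ t, 0 ≤ t → |f t| ≤ M

/-- The root mean square error of the estimator `T` of `f 0`, based on `n` observations. -/
def rmsRisk (g : ℝ → ℝ) (n : ℕ) (T : (Fin n → ℝ) → ℝ) (f : ℝ → ℝ) : ENNReal :=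
  (∫⁻ y, ENNReal.ofReal (|T y - f 0| ^ 2) ∂(sampleLaw n (obsLaw f g))) ^ (1 / 2 : ℝ)

/-- The minimax risk for the estimation of `f 0` over the class `S`: the infimum over all
(measurable) estimators of the maximal risk over `S`. -/
def minimaxRisk (g : ℝ → ℝ) (S : Set (ℝ → ℝ)) (n : ℕ) : ENNReal :=
  ⨅ (T : (Fin n → ℝ) → ℝ) (_ : Measurable T), ⨆ f ∈ S, rmsRisk g n T f

/-- The behaviour of the error density near the origin. -/
def NearZeroCondition (p q δ c₀ C₀ : ℝ) (g : ℝ → ℝ) : Prop :=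
  ∀ x ∈ Ioo 0 δ,
    c₀ * x ^ (-p) * Real.log (1 / x) ^ q ≤ g x ∧ g x ≤ C₀ * x ^ (-p) * Real.log (1 / x) ^ q

/-- The Mellin transform of `g` converges absolutely in the closed strip `1 ≤ Re z ≤ 1 + ε` and is
bounded by `C₄` on the line `Re z = 1 + ε`. -/
def MellinStripCondition (ε C₄ : ℝ) (g : ℝ → ℝ) : Prop :=
  (∀ z : ℂ, 1 ≤ z.re → z.re ≤ 1 + ε → MellinConvergent (fun x => (g x : ℂ)) z) ∧
  ∀ ω : ℝ, ‖mellin (fun x => (g x : ℂ)) (1 + ε + ω * Complex.I)‖ ≤ C₄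

/-- The exponent of the additional logarithm: `1` if `p = 0` and `0` otherwise. -/
def kappa (p : ℝ) : ℝ := if p = 0 then 1 else 0

/-- The rate of convergence. -/
def lowerRate (β p q A M : ℝ) (n : ℕ) : ℝ :=
  A ^ ((p + 1) / (2 * β + 1 + p)) *
    (M ^ (1 - p) * Real.log n ^ (q + kappa p) / n) ^ (β / (2 * β + 1 + p))

/-- The lower limit, as `n → ∞`, of the minimax risk divided by the rate. -/
def normalizedRiskLiminf (g : ℝ → ℝ) (β p q r A M : ℝ) : ENNReal :=
  liminf (fun n : ℕ =>
    minimaxRisk g {f | HolderClass r A β M f} n / ENNReal.ofReal (lowerRate β p q A M n)) atTop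

end

/-!
The lower bound is obtained by the two-point method.  The first hypothesis is a Lomax density `f₀`
with scale `b⁻¹`; it is of the order `b` near the origin and decays polynomially.  The second one is
the mixture `f₁ = (1 - τ) f₀ + τ f_h` with the exponential density `f_h` with mean `h`, where
`τ = c A h ^ (β + 1)`.  It is a density automatically, and differs from `f₀` near the origin
essentially by a bump of height `c A h ^ β` and width `h`.  Therefore it stays in the Hölder class
for a small constant `c` (`holderClass_hypDensity`), while the values of the two densities at the
origin differ by the order of `A h ^ β`.

Let `k₀` and `k_h` be the densities of an observation that belong to `f₀` and `f_h`.  Since a mixture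
of densities leads to the same mixture of the laws of an observation, the second moment of the
likelihood ratio of one observation is at most `1 + τ² ∫ k_h² / k₀`
(`exists_likelihoodRatio_mixture`).  A Cauchy–Schwarz argument (`abs_sub_le_rms_add_rms`) shows that
no estimator can be better than `A h ^ β`, up to a constant, once `n τ² ∫ k_h² / k₀ ≤ 1`.

Two estimates are needed to bound this integral.  The Cauchy–Schwarz inequality with a suitable
weight and Tonelli's theorem give
`∫ k_h² y ^ s ≤ C h ^ (s - 1) (E η ^ ((s - 1) / 2))²` (`lintegral_obsDensity_sq_mul_rpow_le`).
On the other hand, `k₀ y` is at least of the order of `b ^ (1 - p) y ^ (-p) (ln (1 / y)) ^ (q + κ)`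
near the origin (`le_obsDensity_lomaxDensity_of_small`), and it decays like the density `f₀`
(`exists_le_obsDensity_lomaxDensity`).  With `s = p` for `y ≤ h ^ ρ` and `s = 1 + 2 e` for the other
values of `y`, where `e = min ε 1` is also the tail index of `f₀`, the integral turns out to be of
the order of `b ^ (p - 1) h ^ (p - 1) (ln (1 / h)) ^ (-(q + κ))`.  The moment of order `(p - 1) / 2`
is controlled by the behaviour of `g` near the origin, and the one of order `e` is finite since the
Mellin transform converges at `1 + e`.

Equating `n τ²` times this order to a constant determines `h` (`bandwidth`), and `A h ^ β` is the
rate with `b` in the place of `M` (`lowerRate_eq`).  For large `A` the choice `b = M / 2` is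
admissible; in general `b` has to be small in terms of `A`, which only affects the constant.
-/

/-! ### The two-point method -/

theorem lintegral_pi_prod_eq_pow {Ω : Type*} [MeasurableSpace Ω] (n : ℕ) (μ : Measure Ω)
    [IsProbabilityMeasure μ] {F : Fin n → Ω → ENNReal} (hF : ∀ i, Measurable (F i)) :
    ∫⁻ y, ∏ i, F i (y i) ∂(Measure.pi fun _ : Fin n => μ) = ∏ i, ∫⁻ x, F i x ∂μ := by
  have h := ProbabilityTheory.lintegral_prod_eq_prod_lintegral_of_indepFun Finset.univ _
    (ProbabilityTheory.iIndepFun_pi (μ := fun _ : Fin n => μ) fun i => (hF i).aemeasurable)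
    fun i => (hF i).comp (measurable_pi_apply i)
  rw [h]
  refine Finset.prod_congr rfl fun i _ => ?_
  exact (measurePreserving_eval (fun _ : Fin n => μ) i).lintegral_comp (hF i)

theorem pi_withDensity_eq {Ω : Type*} [MeasurableSpace Ω] (n : ℕ) (μ : Measure Ω)
    [IsProbabilityMeasure μ] {L : Ω → ENNReal} (hL : Measurable L)
    [IsProbabilityMeasure (μ.withDensity L)] :
    (Measure.pi fun _ : Fin n => μ.withDensity L) =
      (Measure.pi fun _ : Fin n => μ).withDensity fun y => ∏ i, L (y i) := by
  refine Measure.pi_eq (μ := fun _ : Fin n => μ.withDensity L) fun s hs => ?_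
  rw [withDensity_apply _ (MeasurableSet.univ_pi hs),
    ← lintegral_indicator (MeasurableSet.univ_pi hs)]
  have h : ∀ y : Fin n → Ω, (univ.pi s).indicator (fun y => ∏ i, L (y i)) y =
      ∏ i, (s i).indicator L (y i) := by
    intro y
    by_cases hy : y ∈ univ.pi s
    · rw [indicator_of_mem hy]
      exact Finset.prod_congr rfl fun i _ => (indicator_of_mem (hy i (mem_univ i)) L).symm
    · rw [indicator_of_notMem hy]
      simp only [Set.mem_pi, mem_univ, true_implies, not_forall] at hy
      obtain ⟨i, hi⟩ := hy
      exact (Finset.prod_eq_zero (Finset.mem_univ i) (indicator_of_notMem hi L)).symm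
  simp_rw [h]
  rw [lintegral_pi_prod_eq_pow n μ fun i => hL.indicator (hs i)]
  refine Finset.prod_congr rfl fun i _ => ?_
  rw [withDensity_apply _ (hs i), lintegral_indicator (hs i)]

theorem lintegral_mul_le_sqrt_mul_sqrt {Ω : Type*} [MeasurableSpace Ω] (μ : Measure Ω)
    {F G : Ω → ENNReal} (hF : Measurable F) (hG : Measurable G) :
    ∫⁻ x, F x * G x ∂μ ≤ (∫⁻ x, F x ^ 2 ∂μ) ^ (1 / 2 : ℝ) * (∫⁻ x, G x ^ 2 ∂μ) ^ (1 / 2 : ℝ) := by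
  simpa using ENNReal.lintegral_mul_le_Lp_mul_Lq μ Real.HolderConjugate.two_two
    hF.aemeasurable hG.aemeasurable

/-- Two hypotheses that differ by `|θ₁ - θ₀|` cannot both be estimated with a root mean square
error much smaller than this difference, as long as the likelihood ratio of the two laws has a
bounded second moment: under the second law the estimator is also close to `θ₀`, by the
Cauchy–Schwarz inequality and a change of measure. -/
theorem abs_sub_le_rms_add_rms {Ω : Type*} [MeasurableSpace Ω] (n : ℕ) (μ : Measure Ω)
    [IsProbabilityMeasure μ] {L : Ω → ENNReal} (hL : Measurable L)
    [IsProbabilityMeasure (μ.withDensity L)] {T : (Fin n → Ω) → ℝ} (hT : Measurable T)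
    (θ₀ θ₁ : ℝ) :
    ENNReal.ofReal |θ₁ - θ₀| ≤
      (∫⁻ y, ENNReal.ofReal (|T y - θ₁| ^ 2)
        ∂(Measure.pi fun _ : Fin n => μ.withDensity L)) ^ (1 / 2 : ℝ) +
      (∫⁻ y, ENNReal.ofReal (|T y - θ₀| ^ 2) ∂(Measure.pi fun _ : Fin n => μ)) ^ (1 / 2 : ℝ) *
        ((∫⁻ x, L x ^ 2 ∂μ) ^ n) ^ (1 / 2 : ℝ) := by
  set P := Measure.pi fun _ : Fin n => μ
  set Q := Measure.pi fun _ : Fin n => μ.withDensity L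
  have hmeas : ∀ θ : ℝ, Measurable fun y => ENNReal.ofReal |T y - θ| := by
    intro θ; fun_prop
  have hL' : Measurable fun y : Fin n → Ω => ∏ i, L (y i) :=
    Finset.measurable_fun_prod _ fun i _ => hL.comp (measurable_pi_apply i)
  have hsq : ∀ θ y, ENNReal.ofReal (|T y - θ| ^ 2) = ENNReal.ofReal |T y - θ| ^ 2 :=
    fun θ y => ENNReal.ofReal_pow (abs_nonneg _) 2
  simp_rw [hsq]
  calc ENNReal.ofReal |θ₁ - θ₀| = ∫⁻ _, ENNReal.ofReal |θ₁ - θ₀| ∂Q := by simp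
    _ ≤ ∫⁻ y, (ENNReal.ofReal |T y - θ₁| + ENNReal.ofReal |T y - θ₀|) ∂Q := by
        refine lintegral_mono fun y => ?_
        rw [← ENNReal.ofReal_add (abs_nonneg _) (abs_nonneg _)]
        refine ENNReal.ofReal_le_ofReal ?_
        rw [abs_sub_comm (T y) θ₁]
        simpa using abs_add_le (θ₁ - T y) (T y - θ₀)
    _ = ∫⁻ y, ENNReal.ofReal |T y - θ₁| * 1 ∂Q +
          ∫⁻ y, ENNReal.ofReal |T y - θ₀| * ∏ i, L (y i) ∂P := by
        rw [lintegral_add_left (hmeas θ₁)]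
        simp only [mul_one]
        congr 1
        rw [show Q = P.withDensity fun y => ∏ i, L (y i) from pi_withDensity_eq n μ hL,
          lintegral_withDensity_eq_lintegral_mul _ hL' (hmeas θ₀)]
        simp [mul_comm]
    _ ≤ _ := by
        refine add_le_add ?_ ?_
        · refine (lintegral_mul_le_sqrt_mul_sqrt Q (hmeas θ₁) measurable_const).trans ?_
          simp
        · refine (lintegral_mul_le_sqrt_mul_sqrt P (hmeas θ₀) hL').trans (le_of_eq ?_)
          congr 2
          simp_rw [← Finset.prod_pow]
          rw [lintegral_pi_prod_eq_pow n μ (F := fun _ x => L x ^ 2) fun _ => hL.pow_const 2]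
          simp

/-! ### The density of an observation -/

/-- The density at `y` of the product of independent variables with densities `f` and `g`, where
the second one is positive: the multiplicative convolution `∫₀^∞ f (y / u) g(u) / u du`. -/
noncomputable def obsDensity (f g : ℝ → ℝ) (y : ℝ) : ENNReal :=
  ∫⁻ u in Ioi 0, ENNReal.ofReal (f (y / u)) * ENNReal.ofReal (u⁻¹ * g u)

theorem lintegral_comp_mul_right_eq {a : ℝ} (ha : 0 < a) {F : ℝ → ENNReal} (hF : Measurable F) :
    ∫⁻ x, F (x * a) = ENNReal.ofReal a⁻¹ * ∫⁻ x, F x := by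
  rw [← lintegral_map hF (measurable_mul_const a), Real.map_volume_mul_right ha.ne',
    lintegral_smul_measure, abs_of_pos (inv_pos.2 ha), smul_eq_mul]

theorem measurable_obsDensity_integrand {f g : ℝ → ℝ} (hf : Measurable f) (hg : Measurable g) :
    Measurable fun z : ℝ × ℝ => ENNReal.ofReal (f (z.1 / z.2)) * ENNReal.ofReal (z.2⁻¹ * g z.2) := by
  fun_prop

theorem measurable_obsDensity {f g : ℝ → ℝ} (hf : Measurable f) (hg : Measurable g) :
    Measurable (obsDensity f g) :=
  (measurable_obsDensity_integrand hf hg).lintegral_prod_right'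

theorem lintegral_densityLaw {f : ℝ → ℝ} (hf : Measurable f) {F : ℝ → ENNReal}
    (hF : Measurable F) :
    ∫⁻ x, F x ∂(densityLaw f) = ∫⁻ x, ENNReal.ofReal (f x) * F x := by
  rw [densityLaw, lintegral_withDensity_eq_lintegral_mul _ hf.ennreal_ofReal hF]
  rfl

theorem lintegral_eq_setLIntegral_Ioi {F : ℝ → ENNReal} (hF : ∀ x < 0, F x = 0) :
    ∫⁻ x, F x = ∫⁻ x in Ioi 0, F x := by
  rw [restrict_Ioi_eq_restrict_Ici, ← lintegral_indicator measurableSet_Ici]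
  refine lintegral_congr fun x => ?_
  by_cases hx : x ∈ Ici 0
  · rw [indicator_of_mem hx]
  · rw [indicator_of_notMem hx, hF x (by simpa using hx)]

theorem obsLaw_eq_withDensity {f g : ℝ → ℝ} (hf : Measurable f) (hg : IsNonnegDensity g) :
    obsLaw f g = volume.withDensity (obsDensity f g) := by
  refine Measure.ext_of_lintegral _ fun F hF => ?_
  have hg' := hg.measurable
  rw [obsLaw, lintegral_map hF (by fun_prop), lintegral_prod_symm _ (by fun_prop),
    lintegral_densityLaw hg' (by fun_prop),
    lintegral_withDensity_eq_lintegral_mul _ (measurable_obsDensity hf hg') hF,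
    lintegral_eq_setLIntegral_Ioi fun u hu => by simp [hg.eq_zero_of_neg u hu]]
  have h1 : ∀ u ∈ Ioi (0 : ℝ),
      ENNReal.ofReal (g u) * ∫⁻ x, F (x * u) ∂(densityLaw f) =
        ∫⁻ y, ENNReal.ofReal (f (y / u)) * ENNReal.ofReal (u⁻¹ * g u) * F y := by
    intro u hu
    have hu' : (0 : ℝ) < u := hu
    have h2 : ∀ x, ENNReal.ofReal (f x) * F (x * u) =
        (fun y => ENNReal.ofReal (f (y / u)) * F y) (x * u) := by
      intro x; simp [mul_div_cancel_right₀ _ hu'.ne']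
    rw [lintegral_densityLaw hf (by fun_prop)]
    rw [lintegral_congr h2, lintegral_comp_mul_right_eq hu'
      (F := fun y => ENNReal.ofReal (f (y / u)) * F y) (by fun_prop), ← mul_assoc,
      ← lintegral_const_mul _ (by fun_prop)]
    refine lintegral_congr fun y => ?_
    rw [ENNReal.ofReal_mul (inv_pos.2 hu').le]
    ring
  rw [setLIntegral_congr_fun measurableSet_Ioi h1, lintegral_lintegral_swap]
  · refine lintegral_congr fun y => ?_
    simp only [Pi.mul_apply, obsDensity]
    rw [lintegral_mul_const _ (by fun_prop)]
  · have := (measurable_obsDensity_integrand hf hg')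
    exact ((this.comp measurable_swap).mul (hF.comp measurable_snd)).aemeasurable

theorem obsDensity_of_neg {f : ℝ → ℝ} (hf : ∀ x, x < 0 → f x = 0) (g : ℝ → ℝ) {y : ℝ}
    (hy : y < 0) : obsDensity f g y = 0 := by
  rw [obsDensity, setLIntegral_congr_fun (g := fun _ => 0) measurableSet_Ioi]
  · simp
  · intro u hu
    simp [hf _ (div_neg_of_neg_of_pos hy hu)]

theorem lintegral_obsDensity {f g : ℝ → ℝ} (hf : IsNonnegDensity f) (hg : IsNonnegDensity g) :
    ∫⁻ y, obsDensity f g y = 1 := by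
  have := isProbabilityMeasure_obsLaw hf hg
  have h : obsLaw f g univ = 1 := measure_univ
  rwa [obsLaw_eq_withDensity hf.measurable hg, withDensity_apply _ MeasurableSet.univ,
    Measure.restrict_univ] at h

theorem obsDensity_mixture {f₀ f₁ g : ℝ → ℝ} (hf₀ : IsNonnegDensity f₀) (hf₁ : IsNonnegDensity f₁)
    (hg : Measurable g) {τ : ℝ} (h0 : 0 ≤ τ) (h1 : τ ≤ 1) (y : ℝ) :
    obsDensity (fun x => (1 - τ) * f₀ x + τ * f₁ x) g y =
      ENNReal.ofReal (1 - τ) * obsDensity f₀ g y + ENNReal.ofReal τ * obsDensity f₁ g y := by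
  have hm₀ := hf₀.measurable
  have hm₁ := hf₁.measurable
  unfold obsDensity
  rw [← lintegral_const_mul _ (by fun_prop), ← lintegral_const_mul _ (by fun_prop),
    ← lintegral_add_left (by fun_prop)]
  refine lintegral_congr fun u => ?_
  rw [ENNReal.ofReal_add (mul_nonneg (by linarith) (hf₀.nonneg _)) (mul_nonneg h0 (hf₁.nonneg _)),
    ENNReal.ofReal_mul (by linarith), ENNReal.ofReal_mul h0]
  ring

/-- If `f₀` is perturbed to the mixture `(1 - τ) f₀ + τ f₁`, then the law of an observation is
multiplied by a likelihood ratio whose second moment exceeds `1` by at most `τ²` times the second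
moment of the ratio of the densities belonging to `f₁` and `f₀`.  The linear terms disappear as
both are probability densities. -/
theorem exists_likelihoodRatio_mixture {f₀ f₁ g : ℝ → ℝ} (hf₀ : IsNonnegDensity f₀)
    (hf₁ : IsNonnegDensity f₁) (hg : IsNonnegDensity g) {τ : ℝ} (h0 : 0 ≤ τ) (h1 : τ ≤ 1)
    (hpos : ∀ y, 0 < y → obsDensity f₀ g y ≠ 0) :
    ∃ L : ℝ → ENNReal, Measurable L ∧
      obsLaw (fun x => (1 - τ) * f₀ x + τ * f₁ x) g = (obsLaw f₀ g).withDensity L ∧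
      ∫⁻ y, L y ^ 2 ∂(obsLaw f₀ g) ≤
        1 + ENNReal.ofReal (τ ^ 2) * ∫⁻ y in Ioi 0, obsDensity f₁ g y ^ 2 / obsDensity f₀ g y := by
  set k₀ := obsDensity f₀ g with hk₀
  set k₁ := obsDensity f₁ g with hk₁
  have hm₀ : Measurable k₀ := measurable_obsDensity hf₀.measurable hg.measurable
  have hm₁ : Measurable k₁ := measurable_obsDensity hf₁.measurable hg.measurable
  set L : ℝ → ENNReal := fun y => ENNReal.ofReal (1 - τ) + ENNReal.ofReal τ * (k₁ y / k₀ y)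
    with hL
  have hmL : Measurable L := by fun_prop
  have hfin : ∀ᵐ y, k₀ y ≠ ⊤ := by
    refine (ae_lt_top hm₀ ?_).mono fun y hy => hy.ne
    rw [hk₀, lintegral_obsDensity hf₀ hg]; exact ENNReal.one_ne_top
  have hne : ∀ᵐ y : ℝ, y ≠ 0 := by simp [ae_iff]
  have hR : ∀ᵐ y, k₀ y * (k₁ y / k₀ y) = k₁ y := by
    filter_upwards [hfin, hne] with y hy hy0
    rcases lt_or_gt_of_ne hy0 with h | h
    · simp [hk₀, hk₁, obsDensity_of_neg hf₀.eq_zero_of_neg g h,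
        obsDensity_of_neg hf₁.eq_zero_of_neg g h]
    · exact ENNReal.mul_div_cancel (hpos y h) hy
  have hmm : Measurable fun x => (1 - τ) * f₀ x + τ * f₁ x :=
    (hf₀.measurable.const_mul _).add (hf₁.measurable.const_mul _)
  refine ⟨L, hmL, ?_, ?_⟩
  · rw [obsLaw_eq_withDensity hmm hg, obsLaw_eq_withDensity hf₀.measurable hg,
      ← withDensity_mul _ hm₀ hmL]
    refine withDensity_congr_ae ?_
    filter_upwards [hR] with y hy
    rw [obsDensity_mixture hf₀ hf₁ hg.measurable h0 h1, Pi.mul_apply, ← hk₀, ← hk₁, hL]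
    conv_lhs => rw [← hy]
    ring
  · have hs : ENNReal.ofReal (1 - τ) + ENNReal.ofReal τ = 1 := by
      rw [← ENNReal.ofReal_add (by linarith) h0]; simp
    have hexp : ∀ᵐ y, k₀ y * L y ^ 2 =
        ENNReal.ofReal (1 - τ) ^ 2 * k₀ y
          + 2 * ENNReal.ofReal (1 - τ) * ENNReal.ofReal τ * k₁ y
          + ENNReal.ofReal τ ^ 2 * (k₁ y ^ 2 / k₀ y) := by
      filter_upwards [hR] with y hy
      have h2 : k₁ y ^ 2 / k₀ y = k₁ y * (k₁ y / k₀ y) := by rw [sq, mul_div_assoc]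
      have h3 : k₀ y * (k₁ y / k₀ y) ^ 2 = k₁ y ^ 2 / k₀ y := by
        rw [sq, ← mul_assoc, hy, h2]
      rw [← h3]
      calc _ = ENNReal.ofReal (1 - τ) ^ 2 * k₀ y
          + 2 * ENNReal.ofReal (1 - τ) * ENNReal.ofReal τ * (k₀ y * (k₁ y / k₀ y))
          + ENNReal.ofReal τ ^ 2 * (k₀ y * (k₁ y / k₀ y) ^ 2) := by rw [hL]; ring
        _ = _ := by rw [hy]
    rw [obsLaw_eq_withDensity hf₀.measurable hg,
      lintegral_withDensity_eq_lintegral_mul _ hm₀ (hmL.pow_const 2)]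
    simp only [Pi.mul_apply]
    rw [lintegral_congr_ae hexp, lintegral_add_left (by fun_prop), lintegral_add_left (by fun_prop),
      lintegral_const_mul _ hm₀, lintegral_const_mul _ hm₁, lintegral_const_mul _ (by fun_prop),
      hk₀, hk₁, lintegral_obsDensity hf₀ hg, lintegral_obsDensity hf₁ hg, mul_one, mul_one,
      ← ENNReal.ofReal_pow h0, lintegral_eq_setLIntegral_Ioi (F := fun y => _ / _)]
    · refine add_le_add ?_ le_rfl
      calc _ ≤ (ENNReal.ofReal (1 - τ) + ENNReal.ofReal τ) ^ 2 := by
            rw [add_sq]; exact le_self_add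
        _ = 1 := by rw [hs, one_pow]
    · intro y hy
      simp [obsDensity_of_neg hf₁.eq_zero_of_neg g hy]

/-! ### Weighted second moments of the density of an observation -/

/-- The moment of order `t` of a positive random variable with density `g`. -/
noncomputable def posMoment (g : ℝ → ℝ) (t : ℝ) : ENNReal :=
  ∫⁻ u in Ioi 0, ENNReal.ofReal (g u) * ENNReal.ofReal (u ^ t)

theorem setLIntegral_comp_mul_right_eq {a : ℝ} (ha : 0 < a) {F : ℝ → ENNReal} (hF : Measurable F) :
    ∫⁻ x in Ioi 0, F (x * a) = ENNReal.ofReal a⁻¹ * ∫⁻ x in Ioi 0, F x := by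
  rw [← lintegral_indicator measurableSet_Ioi, ← lintegral_indicator measurableSet_Ioi,
    ← lintegral_comp_mul_right_eq ha (hF.indicator measurableSet_Ioi)]
  refine lintegral_congr fun x => ?_
  simp only [indicator, mem_Ioi, mul_pos_iff_of_pos_right ha]

/-- The second moment of the density of `X η` with the weight `y ^ s` is controlled by the moment of
`η` of order `(s - 1) / 2`.  This is the choice of the order for which the weight `u ^ ((s - 1) / 2)`
in the Cauchy–Schwarz inequality reproduces itself under the substitution `y = x u`. -/
theorem lintegral_obsDensity_sq_mul_rpow_le {f g : ℝ → ℝ} (hf : Measurable f) (hg : Measurable g)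
    (s : ℝ) :
    ∫⁻ y in Ioi 0, obsDensity f g y ^ 2 * ENNReal.ofReal (y ^ s) ≤
      posMoment g ((s - 1) / 2) ^ 2 *
        ∫⁻ x in Ioi 0, ENNReal.ofReal (f x) ^ 2 * ENNReal.ofReal (x ^ s) := by
  set t := (s - 1) / 2 with ht
  set I := ∫⁻ x in Ioi 0, ENNReal.ofReal (f x) ^ 2 * ENNReal.ofReal (x ^ s) with hI
  set μ := (volume.restrict (Ioi (0 : ℝ))).withDensity fun u => ENNReal.ofReal (g u) with hμ
  have hμint : ∀ F : ℝ → ENNReal, Measurable F →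
      ∫⁻ u, F u ∂μ = ∫⁻ u in Ioi 0, ENNReal.ofReal (g u) * F u := by
    intro F hF
    rw [hμ, lintegral_withDensity_eq_lintegral_mul _ hg.ennreal_ofReal hF]
    rfl
  have hcs : ∀ y, obsDensity f g y ^ 2 ≤
      (∫⁻ u in Ioi 0, ENNReal.ofReal (g u) *
        (ENNReal.ofReal (f (y / u)) ^ 2 * ENNReal.ofReal (u ^ (-2 - t)))) * posMoment g t := by
    intro y
    have h1 : obsDensity f g y = ∫⁻ u, (ENNReal.ofReal (f (y / u)) *
        ENNReal.ofReal (u ^ (-1 - t / 2))) * ENNReal.ofReal (u ^ (t / 2)) ∂μ := by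
      rw [hμint _ (by fun_prop), obsDensity]
      refine setLIntegral_congr_fun measurableSet_Ioi fun u hu => ?_
      have hu' : (0 : ℝ) < u := hu
      have : u⁻¹ = u ^ (-1 - t / 2) * u ^ (t / 2) := by
        rw [← Real.rpow_add hu', ← Real.rpow_neg_one]; ring_nf
      simp only [this, mul_assoc]
      rw [ENNReal.ofReal_mul (by positivity), ENNReal.ofReal_mul (by positivity)]
      ring
    have h2 := lintegral_mul_le_sqrt_mul_sqrt μ (F := fun u => ENNReal.ofReal (f (y / u)) *
        ENNReal.ofReal (u ^ (-1 - t / 2))) (G := fun u => ENNReal.ofReal (u ^ (t / 2)))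
        (by fun_prop) (by fun_prop)
    have hsqrt : ∀ x : ENNReal, (x ^ (1 / 2 : ℝ)) ^ 2 = x := by
      intro x
      rw [← ENNReal.rpow_natCast, ← ENNReal.rpow_mul]; norm_num
    rw [h1]
    refine (pow_le_pow_left' h2 2).trans (le_of_eq ?_)
    rw [mul_pow, hsqrt, hsqrt, hμint _ (by fun_prop), hμint _ (by fun_prop), posMoment]
    congr 1
    · refine setLIntegral_congr_fun measurableSet_Ioi fun u hu => ?_
      have hu' : (0 : ℝ) < u := hu
      rw [mul_pow, ← ENNReal.ofReal_pow (by positivity) 2 (p := u ^ _),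
        ← Real.rpow_natCast, ← Real.rpow_mul hu'.le]
      ring_nf
    · refine setLIntegral_congr_fun measurableSet_Ioi fun u hu => ?_
      have hu' : (0 : ℝ) < u := hu
      rw [← ENNReal.ofReal_pow (by positivity), ← Real.rpow_natCast, ← Real.rpow_mul hu'.le]
      norm_num
  have hmeas : Measurable fun z : ℝ × ℝ => ENNReal.ofReal (g z.2) *
      (ENNReal.ofReal (f (z.1 / z.2)) ^ 2 * ENNReal.ofReal (z.2 ^ (-2 - t)))
        * ENNReal.ofReal (z.1 ^ s) := by fun_prop
  calc ∫⁻ y in Ioi 0, obsDensity f g y ^ 2 * ENNReal.ofReal (y ^ s)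
      ≤ ∫⁻ y in Ioi 0, posMoment g t * ∫⁻ u in Ioi 0, ENNReal.ofReal (g u) *
        (ENNReal.ofReal (f (y / u)) ^ 2 * ENNReal.ofReal (u ^ (-2 - t)))
          * ENNReal.ofReal (y ^ s) := by
        refine lintegral_mono fun y => ?_
        simp only
        rw [lintegral_mul_const _ (by fun_prop), ← mul_assoc, mul_comm (posMoment g t)]
        gcongr
        exact hcs y
    _ = posMoment g t * ∫⁻ u in Ioi 0, ∫⁻ y in Ioi 0, ENNReal.ofReal (g u) *
        (ENNReal.ofReal (f (y / u)) ^ 2 * ENNReal.ofReal (u ^ (-2 - t)))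
          * ENNReal.ofReal (y ^ s) := by
        rw [lintegral_const_mul _ hmeas.lintegral_prod_right',
          lintegral_lintegral_swap hmeas.aemeasurable]
    _ = posMoment g t * ∫⁻ u in Ioi 0, ENNReal.ofReal (g u) * ENNReal.ofReal (u ^ t) * I := by
        congr 1
        refine setLIntegral_congr_fun measurableSet_Ioi fun u hu => ?_
        have hu' : (0 : ℝ) < u := hu
        have h3 := setLIntegral_comp_mul_right_eq (inv_pos.2 hu')
          (F := fun x => ENNReal.ofReal (f x) ^ 2 * ENNReal.ofReal (x ^ s)) (by fun_prop)
        rw [← hI] at h3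
        have h4 : ∀ y ∈ Ioi (0 : ℝ), ENNReal.ofReal (g u) *
            (ENNReal.ofReal (f (y / u)) ^ 2 * ENNReal.ofReal (u ^ (-2 - t)))
              * ENNReal.ofReal (y ^ s) =
            ENNReal.ofReal (g u) * ENNReal.ofReal (u ^ (-2 - t + s)) *
              (ENNReal.ofReal (f (y * u⁻¹)) ^ 2 * ENNReal.ofReal ((y * u⁻¹) ^ s)) := by
          intro y hy
          have hy' : (0 : ℝ) < y := hy
          have : u ^ (-2 - t) * y ^ s = u ^ (-2 - t + s) * (y * u⁻¹) ^ s := by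
            rw [Real.mul_rpow hy'.le (by positivity), Real.rpow_add hu', Real.inv_rpow hu'.le]
            have : u ^ s ≠ 0 := by positivity
            field_simp
          calc _ = ENNReal.ofReal (g u) * ENNReal.ofReal (f (y / u)) ^ 2 *
                ENNReal.ofReal (u ^ (-2 - t) * y ^ s) := by
                rw [ENNReal.ofReal_mul (by positivity)]; ring
            _ = _ := by
                rw [this, ENNReal.ofReal_mul (by positivity), div_eq_mul_inv]; ring
        rw [setLIntegral_congr_fun measurableSet_Ioi h4, lintegral_const_mul _ (by fun_prop), h3,
          inv_inv, ← mul_assoc, mul_assoc (ENNReal.ofReal (g u)), ← ENNReal.ofReal_mul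
          (by positivity)]
        congr 3
        rw [← Real.rpow_add_one hu'.ne', ht]
        ring_nf
    _ = posMoment g t ^ 2 * I := by
        rw [lintegral_mul_const _ (by fun_prop), sq, mul_assoc]
        rfl

/-- The density of the exponential distribution with mean `h`. -/
noncomputable def expDensity (h x : ℝ) : ℝ := if 0 ≤ x then h⁻¹ * Real.exp (-(h⁻¹ * x)) else 0

theorem measurable_expDensity (h : ℝ) : Measurable (expDensity h) :=
  Measurable.ite measurableSet_Ici (by fun_prop) measurable_const

theorem lintegral_expDensity_sq_mul_rpow {h : ℝ} (hh : 0 < h) (s : ℝ) :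
    ∫⁻ x in Ioi 0, ENNReal.ofReal (expDensity h x) ^ 2 * ENNReal.ofReal (x ^ s) =
      ENNReal.ofReal (h ^ (s - 1)) *
        ∫⁻ z in Ioi 0, ENNReal.ofReal (z ^ s * Real.exp (-(2 * z))) := by
  have hm := measurable_expDensity h
  have h1 := setLIntegral_comp_mul_right_eq hh
    (F := fun x => ENNReal.ofReal (expDensity h x) ^ 2 * ENNReal.ofReal (x ^ s)) (by fun_prop)
  have h2 : ∀ z ∈ Ioi (0 : ℝ), ENNReal.ofReal (expDensity h (z * h)) ^ 2 *
      ENNReal.ofReal ((z * h) ^ s) =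
      ENNReal.ofReal (h⁻¹ * h ^ (s - 1)) * ENNReal.ofReal (z ^ s * Real.exp (-(2 * z))) := by
    intro z hz
    have hz' : (0 : ℝ) < z := hz
    rw [expDensity, if_pos (by positivity), ← ENNReal.ofReal_pow (by positivity),
      ← ENNReal.ofReal_mul (by positivity), ← ENNReal.ofReal_mul (by positivity)]
    congr 1
    rw [mul_pow, ← Real.exp_nat_mul, Real.mul_rpow hz'.le hh.le, Real.rpow_sub_one hh.ne',
      show ((2 : ℕ) : ℝ) * -(h⁻¹ * (z * h)) = -(2 * z) by field_simp; norm_num]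
    ring
  rw [setLIntegral_congr_fun measurableSet_Ioi h2, lintegral_const_mul _ (by fun_prop),
    ENNReal.ofReal_mul (by positivity), mul_assoc] at h1
  have h3 : ENNReal.ofReal h⁻¹ ≠ 0 := by simpa using hh
  exact ((ENNReal.mul_right_inj h3 ENNReal.ofReal_ne_top).1 h1).symm

theorem lintegral_rpow_mul_exp_ne_top {s : ℝ} (hs : -1 < s) :
    ∫⁻ z in Ioi 0, ENNReal.ofReal (z ^ s * Real.exp (-(2 * z))) ≠ ⊤ := by
  have h := integrableOn_rpow_mul_exp_neg_mul_rpow hs zero_lt_one zero_lt_two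
  simp only [Real.rpow_one, neg_mul] at h
  exact (Integrable.lintegral_lt_top h).ne

/-! ### Two families of densities -/

/-- The Lomax (shifted Pareto) density with tail index `a` and scale `b⁻¹`. -/
noncomputable def lomaxDensity (a b x : ℝ) : ℝ := if 0 ≤ x then a * b * (1 + b * x) ^ (-1 - a) else 0

theorem IsNonnegDensity.mixture {f₀ f₁ : ℝ → ℝ} (hf₀ : IsNonnegDensity f₀)
    (hf₁ : IsNonnegDensity f₁) {τ : ℝ} (h0 : 0 ≤ τ) (h1 : τ ≤ 1) :
    IsNonnegDensity fun x => (1 - τ) * f₀ x + τ * f₁ x := by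
  have hm₀ := hf₀.measurable
  have hm₁ := hf₁.measurable
  have h1' : 0 ≤ 1 - τ := by linarith
  refine ⟨by fun_prop, fun x => ?_, fun x hx => ?_, ?_⟩
  · exact add_nonneg (mul_nonneg h1' (hf₀.nonneg x)) (mul_nonneg h0 (hf₁.nonneg x))
  · simp [hf₀.eq_zero_of_neg x hx, hf₁.eq_zero_of_neg x hx]
  · have h : ∀ x, ENNReal.ofReal ((1 - τ) * f₀ x + τ * f₁ x) =
        ENNReal.ofReal (1 - τ) * ENNReal.ofReal (f₀ x) +
          ENNReal.ofReal τ * ENNReal.ofReal (f₁ x) := by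
      intro x
      rw [ENNReal.ofReal_add (mul_nonneg h1' (hf₀.nonneg x)) (mul_nonneg h0 (hf₁.nonneg x)),
        ENNReal.ofReal_mul h1', ENNReal.ofReal_mul h0]
    simp_rw [h]
    rw [lintegral_add_left (by fun_prop), lintegral_const_mul _ (by fun_prop),
      lintegral_const_mul _ (by fun_prop), hf₀.lintegral_eq_one, hf₁.lintegral_eq_one, mul_one,
      mul_one, ← ENNReal.ofReal_add h1' h0]
    simp

/-- A nonnegative function on the half-line with an antiderivative increasing from `-1` to `0` is
a probability density. -/
theorem isNonnegDensity_of_hasDerivAt {F f : ℝ → ℝ} (hm : Measurable f) (h0 : ∀ x, 0 ≤ x → 0 ≤ f x)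
    (hneg : ∀ x, x < 0 → f x = 0) (hF : ∀ x ∈ Ici (0 : ℝ), HasDerivAt F (f x) x) (hF0 : F 0 = -1)
    (hlim : Tendsto F atTop (nhds 0)) : IsNonnegDensity f := by
  have hnn : ∀ x, 0 ≤ f x := fun x => by
    rcases lt_or_ge x 0 with h | h
    · exact (hneg x h).ge
    · exact h0 x h
  refine ⟨hm, hnn, hneg, ?_⟩
  have hpos : ∀ x ∈ Ioi (0 : ℝ), 0 ≤ f x := fun x _ => hnn x
  have hint := integrableOn_Ioi_deriv_of_nonneg' hF hpos hlim
  rw [lintegral_eq_setLIntegral_Ioi fun x hx => by simp [hneg x hx],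
    ← ofReal_integral_eq_lintegral_ofReal hint (ae_of_all _ hnn),
    integral_Ioi_of_hasDerivAt_of_nonneg' hF hpos hlim, hF0]
  simp

theorem isNonnegDensity_lomaxDensity {a b : ℝ} (ha : 0 < a) (hb : 0 < b) :
    IsNonnegDensity (lomaxDensity a b) := by
  refine isNonnegDensity_of_hasDerivAt (F := fun x => -(1 + b * x) ^ (-a)) ?_ ?_ ?_ ?_ ?_ ?_
  · exact Measurable.ite measurableSet_Ici (by fun_prop) measurable_const
  · intro x hx
    rw [lomaxDensity, if_pos hx]
    positivity
  · intro x hx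
    rw [lomaxDensity, if_neg (not_le.2 hx)]
  · intro x hx
    have hx' : (0 : ℝ) ≤ x := hx
    have hpos : 0 < 1 + b * x := by positivity
    have h1 : HasDerivAt (fun x => 1 + b * x) b x := by
      simpa using ((hasDerivAt_id x).const_mul b).const_add 1
    have h2 := (h1.rpow_const (p := -a) (Or.inl hpos.ne')).fun_neg
    refine h2.congr_deriv ?_
    rw [lomaxDensity, if_pos hx']
    rw [show -1 - a = -a - 1 by ring]
    ring
  · simp
  · have h1 : Tendsto (fun x => 1 + b * x) atTop atTop :=
      tendsto_atTop_add_const_left _ _ (tendsto_id.const_mul_atTop hb)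
    simpa using ((tendsto_rpow_neg_atTop ha).comp h1).neg

theorem isNonnegDensity_expDensity {h : ℝ} (hh : 0 < h) : IsNonnegDensity (expDensity h) := by
  refine isNonnegDensity_of_hasDerivAt (F := fun x => -Real.exp (-(h⁻¹ * x)))
    (measurable_expDensity h) ?_ ?_ ?_ ?_ ?_
  · intro x hx
    rw [expDensity, if_pos hx]
    positivity
  · intro x hx
    rw [expDensity, if_neg (not_le.2 hx)]
  · intro x hx
    have hx' : (0 : ℝ) ≤ x := hx
    have h1 : HasDerivAt (fun x => -(h⁻¹ * x)) (-h⁻¹) x := by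
      exact ((hasDerivAt_id' x).const_mul h⁻¹).fun_neg.congr_deriv (by ring)
    rw [expDensity, if_pos hx']
    exact h1.exp.fun_neg.congr_deriv (by ring)
  · simp
  · have h1 : Tendsto (fun x => h⁻¹ * x) atTop atTop := tendsto_id.const_mul_atTop (inv_pos.2 hh)
    simpa using (Real.tendsto_exp_neg_atTop_nhds_zero.comp h1).neg

/-! ### Smoothness of the two families -/

theorem iteratedDerivWithin_eq_of_hasDerivAt {S : Set ℝ} (hS : UniqueDiffOn ℝ S) {f : ℝ → ℝ}
    {D : ℕ → ℝ → ℝ} (h0 : ∀ x ∈ S, f x = D 0 x)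
    (hD : ∀ k, ∀ x ∈ S, HasDerivAt (D k) (D (k + 1) x) x) (k : ℕ) :
    ∀ x ∈ S, iteratedDerivWithin k f S x = D k x := by
  induction k with
  | zero => intro x hx; rw [iteratedDerivWithin_zero, h0 x hx]
  | succ k ih =>
    intro x hx
    rw [iteratedDerivWithin_succ, derivWithin_congr ih (ih x hx)]
    exact (hD k x hx).hasDerivWithinAt.derivWithin (hS x hx)

theorem contDiffOn_of_hasDerivAt {S : Set ℝ} (hS : UniqueDiffOn ℝ S) {f : ℝ → ℝ}
    {D : ℕ → ℝ → ℝ} (h0 : ∀ x ∈ S, f x = D 0 x)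
    (hD : ∀ k, ∀ x ∈ S, HasDerivAt (D k) (D (k + 1) x) x) (n : ℕ) : ContDiffOn ℝ n f S := by
  refine contDiffOn_of_differentiableOn_deriv (n := (n : ℕ∞)) fun m _ => ?_
  refine DifferentiableOn.congr (f := D m) (fun x hx => ?_)
    (iteratedDerivWithin_eq_of_hasDerivAt hS h0 hD m)
  exact (hD m x hx).differentiableAt.differentiableWithinAt

/-- Interpolation: a function with the bound `B`, whose derivative has the bound `B * l`, is Hölder
continuous of any order `s ∈ [0, 1]` with the constant `2 * B * l ^ s`. -/
theorem abs_sub_le_of_bound_of_deriv_bound {S : Set ℝ} (hS : Convex ℝ S) {u u' : ℝ → ℝ}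
    {B l s : ℝ} (hl : 0 ≤ l) (hs0 : 0 ≤ s) (hs1 : s ≤ 1)
    (hu : ∀ x ∈ S, HasDerivAt u (u' x) x) (hB : ∀ x ∈ S, |u x| ≤ B)
    (hB' : ∀ x ∈ S, |u' x| ≤ B * l) {x y : ℝ} (hx : x ∈ S) (hy : y ∈ S) :
    |u x - u y| ≤ 2 * B * l ^ s * |x - y| ^ s := by
  have hBnn : 0 ≤ B := (abs_nonneg _).trans (hB x hx)
  have h1 : |u x - u y| ≤ B * l * |x - y| :=
    hS.norm_image_sub_le_of_norm_hasDerivWithin_le (fun z hz => (hu z hz).hasDerivWithinAt) hB' hy hx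
  have h2 : |u x - u y| ≤ 2 * B := by
    have := abs_sub (u x) (u y)
    linarith [hB x hx, hB y hy]
  rw [mul_assoc, ← Real.mul_rpow hl (abs_nonneg _)]
  have hz : 0 ≤ l * |x - y| := mul_nonneg hl (abs_nonneg _)
  rcases le_total (l * |x - y|) 1 with h | h
  · have h3 := Real.rpow_le_rpow_of_exponent_ge' hz h hs0 hs1
    rw [Real.rpow_one] at h3
    nlinarith
  · have h3 := Real.one_le_rpow h hs0
    nlinarith

/-- The `k`-th derivative of the Lomax density on the positive half-line. -/
noncomputable def lomaxDeriv (a b : ℝ) (k : ℕ) (x : ℝ) : ℝ :=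
  a * b * (∏ j ∈ Finset.range k, (-b * (1 + a + j))) * (1 + b * x) ^ (-1 - a - k)

theorem hasDerivAt_lomaxDeriv {a b : ℝ} (hb : 0 < b) (k : ℕ) {x : ℝ} (hx : 0 < x) :
    HasDerivAt (lomaxDeriv a b k) (lomaxDeriv a b (k + 1) x) x := by
  have hpos : 0 < 1 + b * x := by positivity
  have h1 : HasDerivAt (fun x => 1 + b * x) b x := by
    simpa using ((hasDerivAt_id x).const_mul b).const_add 1
  have h2 := (h1.rpow_const (p := -1 - a - k) (Or.inl hpos.ne')).const_mul
    (a * b * ∏ j ∈ Finset.range k, (-b * (1 + a + j)))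
  refine h2.congr_deriv ?_
  rw [lomaxDeriv, Finset.prod_range_succ]
  push_cast
  rw [show -1 - a - ((k : ℝ) + 1) = -1 - a - k - 1 by ring]
  ring

theorem abs_lomaxDeriv_le {a b : ℝ} (ha : 0 < a) (ha1 : a ≤ 1) (hb : 0 < b) (k : ℕ) {x : ℝ}
    (hx : 0 < x) : |lomaxDeriv a b k x| ≤ b ^ (k + 1) * (k + 1).factorial := by
  have h1 : |∏ j ∈ Finset.range k, (-b * (1 + a + j))| ≤ b ^ k * (k + 1).factorial := by
    induction k with
    | zero => simp
    | succ k ih =>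
      rw [Finset.prod_range_succ, abs_mul, abs_mul, abs_neg, abs_of_pos hb,
        abs_of_pos (show 0 < 1 + a + (k : ℝ) by positivity), Nat.factorial_succ (k + 1), pow_succ]
      push_cast
      calc _ ≤ (b ^ k * (k + 1).factorial) * (b * (k + 1 + 1)) := by
            gcongr ?_ * (b * ?_)
            linarith
        _ = _ := by ring
  have h2 : (1 + b * x) ^ (-1 - a - k) ≤ 1 :=
    Real.rpow_le_one_of_one_le_of_nonpos (by nlinarith) (by linarith [k.cast_nonneg (α := ℝ)])
  have h3 : 0 ≤ (1 + b * x) ^ (-1 - a - k) := by positivity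
  rw [lomaxDeriv, abs_mul, abs_mul, abs_of_pos (mul_pos ha hb), abs_of_nonneg h3]
  calc _ ≤ (1 * b) * (b ^ k * (k + 1).factorial) * 1 := by gcongr
    _ = _ := by ring

/-- The `k`-th derivative of the exponential density with mean `h` on the positive half-line. -/
noncomputable def expDeriv (h : ℝ) (k : ℕ) (x : ℝ) : ℝ := h⁻¹ * (-h⁻¹) ^ k * Real.exp (-(h⁻¹ * x))

theorem hasDerivAt_expDeriv (h : ℝ) (k : ℕ) (x : ℝ) :
    HasDerivAt (expDeriv h k) (expDeriv h (k + 1) x) x := by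
  have h1 : HasDerivAt (fun x => -(h⁻¹ * x)) (-h⁻¹) x := by
    exact ((hasDerivAt_id' x).const_mul h⁻¹).fun_neg.congr_deriv (by ring)
  refine (h1.exp.const_mul (h⁻¹ * (-h⁻¹) ^ k)).congr_deriv ?_
  rw [expDeriv, pow_succ]
  ring

theorem abs_expDeriv_le {h : ℝ} (hh : 0 < h) (k : ℕ) {x : ℝ} (hx : 0 < x) :
    |expDeriv h k x| ≤ h⁻¹ ^ (k + 1) := by
  have h1 : Real.exp (-(h⁻¹ * x)) ≤ 1 := Real.exp_le_one_iff.2 (by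
    have : 0 < h⁻¹ * x := by positivity
    linarith)
  have hi : 0 < h⁻¹ := inv_pos.2 hh
  rw [expDeriv, abs_mul, abs_mul, abs_pow, abs_neg, abs_of_pos hi, Real.abs_exp, pow_succ']
  exact mul_le_of_le_one_right (by positivity) h1

/-- The two densities to be distinguished, one of them with `c = 0`: the mixture of a Lomax density
and the exponential density with mean `h`, in which the latter has the weight
`c A h ^ (β + 1)`. -/
noncomputable def hypDensity (β A a b c h x : ℝ) : ℝ :=
  (1 - c * A * h ^ (β + 1)) * lomaxDensity a b x + c * A * h ^ (β + 1) * expDensity h x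

theorem hypDensity_zero_sub {β A a b c h : ℝ} (hh : 0 < h) :
    hypDensity β A a b c h 0 - hypDensity β A a b 0 h 0 = c * A * h ^ β * (1 - a * b * h) := by
  simp only [hypDensity, lomaxDensity, expDensity, le_refl, if_true, Real.rpow_add_one hh.ne']
  simp only [mul_zero, add_zero, Real.one_rpow, neg_zero, Real.exp_zero]
  field_simp
  ring

/-- The weights of the mixture are small enough for it to stay in the Hölder class, as the class
contains a neighbourhood of the Lomax density and the exponential part is a small bump of
height `c A h ^ β` and width `h`. -/
theorem holderClass_hypDensity {β A M r a b c h : ℝ} (hβ : 0 < β) (ha : 0 < a)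
    (ha1 : a ≤ 1) (hb : 0 < b) (hA : 0 < A) (hh : 0 < h) (hh1 : h ≤ 1) (hc : 0 ≤ c)
    (hc1 : c ≤ 1 / 4) (hτ : c * A * h ^ (β + 1) ≤ 1) (hbM : b ≤ M / 2)
    (hhM : c * A * h ^ β ≤ M / 2)
    (hbA : ∀ k : ℕ, 1 ≤ k → k ≤ holderOrder β → b ^ (k + 1) * (k + 1).factorial ≤ A / 2)
    (hbA' : 2 * b ^ (β + 1) * (holderOrder β + 2).factorial ≤ A / 2) :
    HolderClass r A β M (hypDensity β A a b c h) := by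
  obtain ⟨τ, hτdef⟩ : ∃ τ, τ = c * A * h ^ (β + 1) := ⟨_, rfl⟩
  have hτ0 : 0 ≤ τ := by rw [hτdef]; positivity
  have hτ1 : τ ≤ 1 := hτdef ▸ hτ
  have h1τ : 0 ≤ 1 - τ := by linarith
  have hf : hypDensity β A a b c h = fun x => (1 - τ) * lomaxDensity a b x + τ * expDensity h x := by
    rw [hτdef]; rfl
  have hℓ : (holderOrder β : ℝ) < β := (isGreatest_holderOrder hβ).1
  have hℓ1 : β ≤ holderOrder β + 1 := by
    by_contra hcon
    have : (holderOrder β + 1 : ℕ) ≤ holderOrder β :=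
      (isGreatest_holderOrder hβ).2 (by simpa using hcon)
    omega
  have hτh : ∀ k : ℕ, τ * h⁻¹ ^ (k + 1) = c * A * h ^ (β - k) := by
    intro k
    have : h ^ (β + 1) = h ^ (β - k) * h ^ (k + 1) := by
      rw [← Real.rpow_natCast, ← Real.rpow_add hh]
      push_cast
      ring_nf
    rw [hτdef, this, inv_pow]
    field_simp
  have hS : UniqueDiffOn ℝ (Ioc 0 r) := uniqueDiffOn_Ioc 0 r
  set D : ℕ → ℝ → ℝ := fun k x => (1 - τ) * lomaxDeriv a b k x + τ * expDeriv h k x with hD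
  have hD0 : ∀ x, 0 ≤ x → hypDensity β A a b c h x = D 0 x := by
    intro x hx
    simp [hf, hD, lomaxDensity, expDensity, lomaxDeriv, expDeriv, if_pos hx]
  have hD0' : ∀ x ∈ Ioc 0 r, hypDensity β A a b c h x = D 0 x := fun x hx => hD0 x hx.1.le
  have hDd : ∀ k, ∀ x ∈ Ioc 0 r, HasDerivAt (D k) (D (k + 1) x) x := fun k x hx =>
    ((hasDerivAt_lomaxDeriv hb k hx.1).const_mul _).fun_add
      ((hasDerivAt_expDeriv h k x).const_mul _)
  have hiter := iteratedDerivWithin_eq_of_hasDerivAt hS hD0' hDd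
  have hdens := (isNonnegDensity_lomaxDensity ha hb).mixture (isNonnegDensity_expDensity hh) hτ0 hτ1
  have hDle : ∀ k : ℕ, ∀ x, 0 < x →
      |D k x| ≤ b ^ (k + 1) * (k + 1).factorial + c * A * h ^ (β - k) := by
    intro k x hx
    rw [← hτh]
    calc |D k x| ≤ |(1 - τ) * lomaxDeriv a b k x| + |τ * expDeriv h k x| := abs_add_le _ _
      _ = (1 - τ) * |lomaxDeriv a b k x| + τ * |expDeriv h k x| := by
        rw [abs_mul, abs_mul, abs_of_nonneg h1τ, abs_of_nonneg hτ0]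
      _ ≤ 1 * (b ^ (k + 1) * (k + 1).factorial) + τ * h⁻¹ ^ (k + 1) := by
        gcongr
        · linarith
        · exact abs_lomaxDeriv_le ha ha1 hb k hx
        · exact abs_expDeriv_le hh k hx
      _ = _ := by rw [one_mul]
  have hcont : Tendsto (hypDensity β A a b c h) (nhdsWithin 0 (Ioi 0))
      (nhds (hypDensity β A a b c h 0)) := by
    have h1 : ContinuousAt (D 0) 0 := by
      simp only [hD, lomaxDeriv, expDeriv]
      have h2 : (1 : ℝ) + b * 0 ≠ 0 := by simp
      fun_prop (disch := first | assumption | exact Or.inl h2)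
    rw [hD0 0 le_rfl]
    refine (h1.tendsto.mono_left nhdsWithin_le_nhds).congr' ?_
    filter_upwards [self_mem_nhdsWithin] with x hx
    exact (hD0 x (le_of_lt hx)).symm
  have hbound : ∀ x, 0 < x → |hypDensity β A a b c h x| ≤ M := by
    intro x hx
    have h1 := hDle 0 x hx
    simp only [zero_add, pow_one, Nat.factorial_one, Nat.cast_one, mul_one, CharP.cast_eq_zero,
      sub_zero] at h1
    rw [hD0 x hx.le]
    linarith
  refine ⟨hf ▸ hdens, hcont, contDiffOn_of_hasDerivAt hS hD0' hDd _, ?_, ?_, ?_⟩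
  · intro k hk1 hk x hx
    rw [hiter k x hx]
    have hkβ : (k : ℝ) ≤ β := by
      have : (k : ℝ) ≤ holderOrder β := by exact_mod_cast hk
      linarith
    have h1 : h ^ (β - k) ≤ 1 := Real.rpow_le_one hh.le hh1 (by linarith)
    have h2 : c * A * h ^ (β - k) ≤ c * A * 1 := by gcongr
    nlinarith [hDle k x hx.1, hbA k hk1 hk]
  · intro x hx y hy
    rw [hiter _ x hx, hiter _ y hy]
    set ℓ := holderOrder β with hℓdef
    have h1 := abs_sub_le_of_bound_of_deriv_bound (s := β - ℓ) (convex_Ioc 0 r)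
      (B := b ^ (ℓ + 1) * (ℓ + 2).factorial) hb.le (by linarith) (by linarith)
      (fun z hz => hasDerivAt_lomaxDeriv (a := a) hb ℓ hz.1)
      (fun z hz => (abs_lomaxDeriv_le ha ha1 hb ℓ hz.1).trans (by
        gcongr
        omega))
      (fun z hz => (abs_lomaxDeriv_le ha ha1 hb (ℓ + 1) hz.1).trans (by
        rw [pow_succ b (ℓ + 1)]
        exact le_of_eq (by ring))) hx hy
    have h2 := abs_sub_le_of_bound_of_deriv_bound (s := β - ℓ) (convex_Ioc 0 r)
      (B := h⁻¹ ^ (ℓ + 1)) (inv_nonneg.2 hh.le) (by linarith) (by linarith)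
      (fun z _ => hasDerivAt_expDeriv h ℓ z)
      (fun z hz => abs_expDeriv_le hh ℓ hz.1)
      (fun z hz => (abs_expDeriv_le hh (ℓ + 1) hz.1).trans_eq (pow_succ _ _)) hx hy
    have h3 : b ^ (ℓ + 1) * b ^ (β - ℓ) = b ^ (β + 1) := by
      rw [← Real.rpow_natCast, ← Real.rpow_add hb]
      push_cast
      ring_nf
    have h4 : τ * (h⁻¹ ^ (ℓ + 1) * h⁻¹ ^ (β - ℓ)) = c * A := by
      rw [← mul_assoc, hτh, Real.inv_rpow hh.le]
      have : h ^ (β - ℓ) ≠ 0 := by positivity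
      field_simp
    set t := |x - y| ^ (β - ℓ) with ht
    have ht0 : 0 ≤ t := by positivity
    calc |D ℓ x - D ℓ y| = |(1 - τ) * (lomaxDeriv a b ℓ x - lomaxDeriv a b ℓ y) +
            τ * (expDeriv h ℓ x - expDeriv h ℓ y)| := by
          simp only [hD]; ring_nf
      _ ≤ (1 - τ) * |lomaxDeriv a b ℓ x - lomaxDeriv a b ℓ y| +
            τ * |expDeriv h ℓ x - expDeriv h ℓ y| := by
          refine (abs_add_le _ _).trans_eq ?_
          rw [abs_mul, abs_mul, abs_of_nonneg h1τ, abs_of_nonneg hτ0]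
      _ ≤ 1 * (2 * (b ^ (ℓ + 1) * (ℓ + 2).factorial) * b ^ (β - ℓ) * t) +
            τ * (2 * h⁻¹ ^ (ℓ + 1) * h⁻¹ ^ (β - ℓ) * t) := by
          gcongr
          linarith
      _ = (2 * b ^ (β + 1) * (ℓ + 2).factorial) * t + 2 * (c * A) * t := by
          rw [← h3, ← h4]; ring
      _ ≤ A / 2 * t + 2 * (1 / 4 * A) * t := by gcongr
      _ = A * t := by ring
  · intro x hx
    rcases hx.eq_or_lt with rfl | hx
    · exact le_of_tendsto hcont.abs
        (eventually_nhdsWithin_of_forall fun z hz => hbound z hz)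
    · exact hbound x hx

/-! ### Moments of the error density -/

/-- The negative moment of order `(p - 1) / 2` of the errors is bounded in terms of the parameters
alone: near the origin by the upper bound for `g`, and elsewhere since `g` is a density. -/
theorem exists_posMoment_le (p q δ C₀ : ℝ) (hp : p < 1) (hq : 0 ≤ q) (hδ : 0 < δ) (hδ1 : δ < 1) :
    ∃ m : ENNReal, m ≠ ⊤ ∧ ∀ (g : ℝ → ℝ) (c₀ : ℝ), IsNonnegDensity g →
      NearZeroCondition p q δ c₀ C₀ g → posMoment g ((p - 1) / 2) ≤ m := by
  set t := (p - 1) / 2 with ht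
  have ht0 : t ≤ 0 := by linarith
  refine ⟨(∫⁻ u in Ioo 0 δ, ENNReal.ofReal (C₀ * u ^ (-p) * Real.log (1 / u) ^ q) *
    ENNReal.ofReal (u ^ t)) + ENNReal.ofReal (δ ^ t), ?_, ?_⟩
  · refine ENNReal.add_ne_top.2 ⟨?_, ENNReal.ofReal_ne_top⟩
    -- A power of the logarithm is absorbed by a power of `u` small enough for integrability.
    set s := (1 - p) / (4 * (q + 1)) with hs
    have hs0 : 0 < s := by
      have : 0 < 1 - p := by linarith
      positivity
    have hsq : s * q ≤ (1 - p) / 4 := by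
      rw [hs, div_mul_eq_mul_div, div_le_div_iff₀ (by positivity) (by norm_num)]
      nlinarith
    have hle : ∀ u ∈ Ioo 0 δ, ENNReal.ofReal (C₀ * u ^ (-p) * Real.log (1 / u) ^ q) *
        ENNReal.ofReal (u ^ t) ≤ ENNReal.ofReal (|C₀| * s⁻¹ ^ q * u ^ (-p - (1 - p) / 4 + t)) := by
      intro u hu
      have hu0 : 0 < u := hu.1
      have hu1 : u ≤ 1 := hu.2.le.trans hδ1.le
      have hlog0 : 0 ≤ Real.log (1 / u) := Real.log_nonneg ((one_le_div hu0).2 hu1)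
      have hlog : Real.log (1 / u) ≤ (1 / u) ^ s / s := Real.log_le_rpow_div (by positivity) hs0
      have hlogq : Real.log (1 / u) ^ q ≤ s⁻¹ ^ q * u ^ (-((1 - p) / 4)) := by
        calc Real.log (1 / u) ^ q ≤ ((1 / u) ^ s / s) ^ q := by gcongr
          _ = s⁻¹ ^ q * u ^ (-(s * q)) := by
            rw [div_eq_mul_inv, Real.mul_rpow (by positivity) (by positivity), mul_comm,
              ← Real.rpow_mul (by positivity), one_div, Real.inv_rpow hu0.le,
              ← Real.rpow_neg hu0.le]
          _ ≤ _ := by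
            gcongr ?_ * ?_
            exact Real.rpow_le_rpow_of_exponent_ge hu0 hu1 (by linarith)
      rw [← ENNReal.ofReal_mul' (by positivity)]
      refine ENNReal.ofReal_le_ofReal ?_
      calc _ ≤ |C₀| * u ^ (-p) * (s⁻¹ ^ q * u ^ (-((1 - p) / 4))) * u ^ t := by
            gcongr
            exact le_abs_self _
        _ = _ := by
            rw [Real.rpow_add hu0, sub_eq_add_neg (-p), Real.rpow_add hu0]
            ring
    refine ne_top_of_le_ne_top ?_ (setLIntegral_mono' measurableSet_Ioo hle)
    have hint : IntervalIntegrable (fun u : ℝ => u ^ (-p - (1 - p) / 4 + t)) volume 0 δ :=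
      intervalIntegral.intervalIntegrable_rpow' (by rw [ht]; linarith)
    rw [intervalIntegrable_iff_integrableOn_Ioo_of_le hδ.le] at hint
    exact (Integrable.lintegral_lt_top (hint.const_mul (|C₀| * s⁻¹ ^ q))).ne
  · intro g c₀ hg hnz
    have hg' := hg.measurable
    rw [posMoment, ← Ioo_union_Ici_eq_Ioi hδ]
    refine (lintegral_union_le _ _ _).trans (add_le_add ?_ ?_)
    · refine setLIntegral_mono' measurableSet_Ioo fun u hu => ?_
      gcongr
      exact (hnz u hu).2
    · calc ∫⁻ u in Ici δ, ENNReal.ofReal (g u) * ENNReal.ofReal (u ^ t)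
          ≤ ∫⁻ u in Ici δ, ENNReal.ofReal (g u) * ENNReal.ofReal (δ ^ t) := by
            refine setLIntegral_mono' measurableSet_Ici fun u hu => ?_
            refine mul_le_mul_right (ENNReal.ofReal_le_ofReal ?_) _
            exact Real.rpow_le_rpow_of_nonpos hδ hu ht0
        _ ≤ ∫⁻ u, ENNReal.ofReal (g u) * ENNReal.ofReal (δ ^ t) := setLIntegral_le_lintegral _ _
        _ = ENNReal.ofReal (δ ^ t) := by
            rw [lintegral_mul_const _ (by fun_prop), hg.lintegral_eq_one, one_mul]

theorem posMoment_ne_top_of_mellinConvergent {g : ℝ → ℝ} (hg : ∀ x, 0 ≤ g x) {t : ℝ}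
    (h : MellinConvergent (fun x => (g x : ℂ)) (1 + t : ℝ)) : posMoment g t ≠ ⊤ := by
  have h1 : ∫⁻ u : ℝ in Ioi 0, ‖(u : ℂ) ^ (((1 + t : ℝ) : ℂ) - 1) • (g u : ℂ)‖ₑ ≠ ⊤ := h.2.ne
  convert h1 using 1
  refine setLIntegral_congr_fun measurableSet_Ioi fun u hu => ?_
  have hu' : (0 : ℝ) < u := hu
  have h2 : ‖(u : ℂ) ^ (((1 + t : ℝ) : ℂ) - 1) • (g u : ℂ)‖ = g u * u ^ t := by
    rw [norm_smul, Complex.norm_cpow_eq_rpow_re_of_pos hu', Complex.norm_real,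
      Real.norm_of_nonneg (hg u)]
    simp [mul_comm]
  rw [← ofReal_norm, h2, ENNReal.ofReal_mul (hg u)]

/-! ### Lower bounds for the density of an observation -/

theorem le_setLIntegral_rpow_Ioc {p v : ℝ} (hp : 0 ≤ p) (hp1 : p < 1) (hv : 0 < v)
    (hv1 : v ≤ 1 / 4) :
    ENNReal.ofReal (1 / 4 * v ^ (-p) * (1 / 2 * Real.log (1 / v)) ^ kappa p) ≤
      ∫⁻ u in Ioc v √v, ENNReal.ofReal (u ^ (-1 - p)) := by
  have hsq : 2 * v ≤ √v := by
    refine Real.le_sqrt_of_sq_le ?_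
    nlinarith
  rcases hp.eq_or_lt with rfl | hp0
  · have hle : v ≤ √v := by linarith
    have hint : IntervalIntegrable (fun u : ℝ => u ^ (-1 - 0 : ℝ)) volume v √v := by
      refine intervalIntegral.intervalIntegrable_rpow (Or.inr ?_)
      rw [uIcc_of_le hle]
      exact fun h => absurd h.1 (not_le.2 hv)
    have hint' := (intervalIntegrable_iff_integrableOn_Ioc_of_le hle).1 hint
    rw [← ofReal_integral_eq_lintegral_ofReal hint', ← intervalIntegral.integral_of_le hle]
    · refine ENNReal.ofReal_le_ofReal ?_
      simp only [sub_zero, Real.rpow_neg_one, neg_zero, Real.rpow_zero, kappa, if_true,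
        Real.rpow_one]
      rw [integral_inv_of_pos hv (by positivity), one_div v, Real.log_inv,
        Real.log_div (Real.sqrt_pos.2 hv).ne' hv.ne', Real.log_sqrt hv.le]
      have : Real.log v ≤ 0 := Real.log_nonpos hv.le (by linarith)
      linarith
    · filter_upwards [ae_restrict_mem measurableSet_Ioc] with u hu
      have : 0 < u := hv.trans hu.1
      positivity
  · calc _ ≤ ENNReal.ofReal ((2 * v) ^ (-1 - p)) * ENNReal.ofReal (2 * v - v) := by
          rw [← ENNReal.ofReal_mul (by positivity)]
          refine ENNReal.ofReal_le_ofReal ?_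
          rw [kappa, if_neg hp0.ne', Real.rpow_zero, mul_one, Real.mul_rpow (by norm_num) hv.le,
            show -1 - p = -p + -1 by ring, Real.rpow_add hv, Real.rpow_neg_one]
          have h4 : (1 / 4 : ℝ) ≤ 2 ^ (-p + -1) := by
            have := Real.rpow_le_rpow_of_exponent_le (x := 2) (by norm_num)
              (show (-2 : ℝ) ≤ -p + -1 by linarith)
            refine le_trans (by norm_num [Real.rpow_neg]) this
          have : (0 : ℝ) < v ^ (-p) := by positivity
          calc 1 / 4 * v ^ (-p) ≤ 2 ^ (-p + -1) * v ^ (-p) := by gcongr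
            _ = _ := by field_simp; ring
      _ = ∫⁻ _ in Ioc v (2 * v), ENNReal.ofReal ((2 * v) ^ (-1 - p)) := by simp
      _ ≤ ∫⁻ u in Ioc v (2 * v), ENNReal.ofReal (u ^ (-1 - p)) := by
          refine setLIntegral_mono' measurableSet_Ioc fun u hu => ENNReal.ofReal_le_ofReal ?_
          exact Real.rpow_le_rpow_of_nonpos (hv.trans hu.1) hu.2 (by linarith)
      _ ≤ _ := lintegral_mono_set (Ioc_subset_Ioc_right hsq)

/-- Near the origin, the density of an observation is at least of the order of
`b (b y) ^ (-p) (ln (1 / (b y))) ^ (q + κ)`.  The errors `u ∈ (b y, √(b y)]` suffice for this: for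
them `y / u` is at most `b⁻¹`, so that the Lomax density is of the order `b`, and `ln (1 / u)` is
comparable to `ln (1 / (b y))`. -/
theorem le_obsDensity_lomaxDensity_of_small {p q δ c₀ C₀ a b y : ℝ} {g : ℝ → ℝ} (hp : 0 ≤ p)
    (hp1 : p < 1) (hq : 0 ≤ q) (hδ : 0 < δ) (hc₀ : 0 < c₀) (ha : 0 < a) (ha1 : a ≤ 1) (hb : 0 < b)
    (hnz : NearZeroCondition p q δ c₀ C₀ g) (hy : 0 < y) (hy1 : b * y ≤ 1 / 4)
    (hyδ : b * y < δ ^ 2) :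
    ENNReal.ofReal (a * b * c₀ / 16 * (b * y) ^ (-p) *
        (1 / 2 * Real.log (1 / (b * y))) ^ (q + kappa p)) ≤
      obsDensity (lomaxDensity a b) g y := by
  set v := b * y with hvdef
  have hv : 0 < v := mul_pos hb hy
  have hsδ : √v < δ := (Real.sqrt_lt' hδ).2 hyδ
  set l := 1 / 2 * Real.log (1 / v) with hl
  have hl0 : 0 < l := by
    have : 0 < Real.log (1 / v) := Real.log_pos (by rw [lt_div_iff₀ hv]; linarith)
    positivity
  calc _ = ENNReal.ofReal (a * b / 4 * (c₀ * l ^ q)) *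
        ENNReal.ofReal (1 / 4 * v ^ (-p) * l ^ kappa p) := by
        rw [← ENNReal.ofReal_mul (by positivity), Real.rpow_add hl0]
        ring_nf
    _ ≤ ENNReal.ofReal (a * b / 4 * (c₀ * l ^ q)) *
        ∫⁻ u in Ioc v √v, ENNReal.ofReal (u ^ (-1 - p)) := by
        gcongr
        exact le_setLIntegral_rpow_Ioc hp hp1 hv hy1
    _ = ∫⁻ u in Ioc v √v, ENNReal.ofReal (a * b / 4 * (c₀ * l ^ q)) *
        ENNReal.ofReal (u ^ (-1 - p)) := by rw [lintegral_const_mul _ (by fun_prop)]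
    _ ≤ ∫⁻ u in Ioc v √v, ENNReal.ofReal (lomaxDensity a b (y / u)) *
        ENNReal.ofReal (u⁻¹ * g u) := by
        refine setLIntegral_mono' measurableSet_Ioc fun u hu => ?_
        have hu0 : 0 < u := hv.trans hu.1
        have hf : a * b / 4 ≤ lomaxDensity a b (y / u) := by
          rw [lomaxDensity, if_pos (by positivity)]
          have h1 : 1 + b * (y / u) ≤ 2 := by
            have : b * (y / u) ≤ 1 := by
              rw [← mul_div_assoc, div_le_one hu0]; exact hu.1.le
            linarith
          have h2 : (1 / 4 : ℝ) ≤ (1 + b * (y / u)) ^ (-1 - a) := by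
            calc (1 / 4 : ℝ) = 2 ^ (-2 : ℝ) := by norm_num [Real.rpow_neg]
              _ ≤ 2 ^ (-1 - a) := Real.rpow_le_rpow_of_exponent_le (by norm_num) (by linarith)
              _ ≤ _ := Real.rpow_le_rpow_of_nonpos (by positivity) h1 (by linarith)
          calc a * b / 4 = a * b * (1 / 4) := by ring
            _ ≤ _ := by gcongr
        have hlog : l ≤ Real.log (1 / u) := by
          have : Real.log u ≤ Real.log v / 2 := by
            rw [← Real.log_sqrt hv.le]
            exact Real.log_le_log hu0 hu.2
          rw [hl, one_div v, one_div u, Real.log_inv, Real.log_inv]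
          linarith
        have hgu : c₀ * l ^ q * u ^ (-1 - p) ≤ u⁻¹ * g u := by
          have h1 := (hnz u ⟨hu0, hu.2.trans_lt hsδ⟩).1
          calc c₀ * l ^ q * u ^ (-1 - p) = u⁻¹ * (c₀ * u ^ (-p) * l ^ q) := by
                rw [sub_eq_add_neg, Real.rpow_add hu0, Real.rpow_neg_one]; ring
            _ ≤ u⁻¹ * (c₀ * u ^ (-p) * Real.log (1 / u) ^ q) := by gcongr
            _ ≤ _ := by gcongr
        rw [ENNReal.ofReal_mul (by positivity), mul_assoc, ← ENNReal.ofReal_mul (by positivity)]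
        gcongr
    _ ≤ _ := lintegral_mono_set fun u hu => hv.trans hu.1

/-- A lower bound for the density of an observation on the whole half-line, which inherits the
polynomial decay of the Lomax density.  Its constant is not explicit. -/
theorem exists_le_obsDensity_lomaxDensity {p q δ c₀ C₀ a b : ℝ} {g : ℝ → ℝ} (hp : 0 ≤ p)
    (hq : 0 ≤ q) (hδ : 0 < δ) (hδ1 : δ < 1) (hc₀ : 0 < c₀) (ha : 0 < a) (hb : 0 < b)
    (hnz : NearZeroCondition p q δ c₀ C₀ g) :
    ∃ c : ℝ, 0 < c ∧ ∀ y, 0 < y →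
      ENNReal.ofReal (c * (max 1 y) ^ (-1 - a)) ≤ obsDensity (lomaxDensity a b) g y := by
  have hlogδ : 0 < Real.log (1 / δ) := Real.log_pos ((one_lt_div hδ).2 hδ1)
  refine ⟨a * b * (1 + 2 * b / δ) ^ (-1 - a) * (c₀ * Real.log (1 / δ) ^ q) * (δ - δ / 2), ?_, ?_⟩
  · have : 0 < δ - δ / 2 := by linarith
    positivity
  · intro y hy
    have hm : 0 < max 1 y := lt_max_of_lt_left one_pos
    set N := a * b * ((1 + 2 * b / δ) * max 1 y) ^ (-1 - a) with hN
    have hN0 : 0 ≤ N := by positivity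
    calc _ = ENNReal.ofReal N * ENNReal.ofReal (c₀ * Real.log (1 / δ) ^ q) *
          ENNReal.ofReal (δ - δ / 2) := by
          rw [← ENNReal.ofReal_mul hN0, ← ENNReal.ofReal_mul (by positivity), hN,
            Real.mul_rpow (by positivity) hm.le]
          ring_nf
      _ = ∫⁻ _ in Ioo (δ / 2) δ,
            ENNReal.ofReal N * ENNReal.ofReal (c₀ * Real.log (1 / δ) ^ q) := by simp
      _ ≤ ∫⁻ u in Ioo (δ / 2) δ, ENNReal.ofReal (lomaxDensity a b (y / u)) *
            ENNReal.ofReal (u⁻¹ * g u) := by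
          refine setLIntegral_mono' measurableSet_Ioo fun u hu => ?_
          have hu0 : 0 < u := (by positivity : 0 < δ / 2).trans hu.1
          have hu1 : u ≤ 1 := hu.2.le.trans hδ1.le
          refine mul_le_mul' (ENNReal.ofReal_le_ofReal ?_) (ENNReal.ofReal_le_ofReal ?_)
          · rw [lomaxDensity, if_pos (by positivity), hN]
            have h1 : 1 + b * (y / u) ≤ (1 + 2 * b / δ) * max 1 y := by
              have h2 : b * (y / u) ≤ 2 * b / δ * max 1 y := by
                calc b * (y / u) ≤ b * (max 1 y / (δ / 2)) := by
                      gcongr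
                      · exact le_max_right _ _
                      · exact hu.1.le
                  _ = _ := by field_simp
              rw [add_mul, one_mul]
              exact add_le_add (le_max_left _ _) h2
            have h3 := Real.rpow_le_rpow_of_nonpos (by positivity) h1
              (show -1 - a ≤ 0 by linarith)
            gcongr
          · have h1 := (hnz u ⟨hu0, hu.2⟩).1
            have h2 : 1 ≤ u ^ (-p) := Real.one_le_rpow_of_pos_of_le_one_of_nonpos hu0 hu1
              (by linarith)
            have h3 : 1 ≤ u⁻¹ := (one_le_inv₀ hu0).2 hu1
            have h4 : Real.log (1 / δ) ≤ Real.log (1 / u) :=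
              Real.log_le_log (by positivity) (one_div_le_one_div_of_le hu0 hu.2.le)
            calc c₀ * Real.log (1 / δ) ^ q = 1 * (c₀ * 1 * Real.log (1 / δ) ^ q) := by ring
              _ ≤ u⁻¹ * (c₀ * u ^ (-p) * Real.log (1 / u) ^ q) := by gcongr
              _ ≤ u⁻¹ * g u := by gcongr
      _ ≤ _ := lintegral_mono_set fun u hu => (by positivity : 0 < δ / 2).trans hu.1

/-! ### The size of the perturbation -/

theorem lintegral_obsDensity_expDensity_sq_div_le {g : ℝ → ℝ} (hg : IsNonnegDensity g)
    {k : ℝ → ENNReal} {p e c₁ c₂ h y₀ : ℝ} (he : 0 < e) (hc₁ : 0 < c₁) (hc₂ : 0 < c₂) (hh : 0 < h)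
    (hy₀ : 0 < y₀) (hy₀1 : y₀ ≤ 1)
    (h1 : ∀ y, 0 < y → y ≤ y₀ → ENNReal.ofReal (c₁ * y ^ (-p)) ≤ k y)
    (h2 : ∀ y, 0 < y → ENNReal.ofReal (c₂ * (max 1 y) ^ (-1 - e)) ≤ k y) :
    ∫⁻ y in Ioi 0, obsDensity (expDensity h) g y ^ 2 / k y ≤
      ENNReal.ofReal (c₁⁻¹ * h ^ (p - 1)) * (posMoment g ((p - 1) / 2) ^ 2 *
        ∫⁻ z in Ioi 0, ENNReal.ofReal (z ^ p * Real.exp (-(2 * z)))) +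
      ENNReal.ofReal (c₂⁻¹ * y₀ ^ (-(1 + 2 * e)) * h ^ (2 * e)) * (posMoment g e ^ 2 *
        ∫⁻ z in Ioi 0, ENNReal.ofReal (z ^ (1 + 2 * e) * Real.exp (-(2 * z)))) := by
  set Q := obsDensity (expDensity h) g with hQ
  have hQm : Measurable Q := measurable_obsDensity (measurable_expDensity h) hg.measurable
  have hW : ∀ s, ∫⁻ y in Ioi 0, Q y ^ 2 * ENNReal.ofReal (y ^ s) ≤
      ENNReal.ofReal (h ^ (s - 1)) * (posMoment g ((s - 1) / 2) ^ 2 *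
        ∫⁻ z in Ioi 0, ENNReal.ofReal (z ^ s * Real.exp (-(2 * z)))) := by
    intro s
    refine (lintegral_obsDensity_sq_mul_rpow_le (measurable_expDensity h) hg.measurable s).trans_eq
      ?_
    rw [lintegral_expDensity_sq_mul_rpow hh]
    ring
  have hdiv : ∀ {y x : ℝ}, 0 < x → ENNReal.ofReal x ≤ k y →
      Q y ^ 2 / k y ≤ Q y ^ 2 * ENNReal.ofReal x⁻¹ := by
    intro y x hx hxk
    rw [div_eq_mul_inv, ENNReal.ofReal_inv_of_pos hx]
    gcongr
  have hle : ∀ y ∈ Ioi (0 : ℝ), Q y ^ 2 / k y ≤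
      ENNReal.ofReal c₁⁻¹ * (Q y ^ 2 * ENNReal.ofReal (y ^ p)) +
        ENNReal.ofReal (c₂⁻¹ * y₀ ^ (-(1 + 2 * e))) *
          (Q y ^ 2 * ENNReal.ofReal (y ^ (1 + 2 * e))) := by
    intro y hy
    have hy' : (0 : ℝ) < y := hy
    rcases le_or_gt y y₀ with hyy | hyy
    · refine le_trans (hdiv (by positivity) (h1 y hy' hyy)) (le_trans (le_of_eq ?_) le_self_add)
      rw [mul_inv, ← Real.rpow_neg hy'.le, neg_neg, ENNReal.ofReal_mul (by positivity)]
      ring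
    · have hm : 0 < max 1 y := lt_max_of_lt_left one_pos
      refine le_trans (hdiv (by positivity) (h2 y hy')) (le_trans ?_ le_add_self)
      rw [← mul_assoc, mul_comm (ENNReal.ofReal _) (Q y ^ 2), mul_assoc,
        ← ENNReal.ofReal_mul (by positivity)]
      gcongr
      rw [mul_inv, ← Real.rpow_neg hm.le, mul_assoc]
      gcongr
      have h3 : max 1 y ≤ y / y₀ := by
        refine max_le ((one_le_div hy₀).2 hyy.le) ?_
        rw [le_div_iff₀ hy₀]
        nlinarith
      calc max 1 y ^ (-(-1 - e)) ≤ max 1 y ^ (1 + 2 * e) :=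
            Real.rpow_le_rpow_of_exponent_le (le_max_left _ _) (by linarith)
        _ ≤ (y / y₀) ^ (1 + 2 * e) := by gcongr
        _ = _ := by
            rw [Real.div_rpow hy'.le hy₀.le, Real.rpow_neg hy₀.le]
            ring
  refine (setLIntegral_mono' measurableSet_Ioi hle).trans ?_
  rw [lintegral_add_left (by fun_prop), lintegral_const_mul _ (by fun_prop),
    lintegral_const_mul _ (by fun_prop), ENNReal.ofReal_mul (q := h ^ (p - 1)) (by positivity),
    ENNReal.ofReal_mul (q := h ^ (2 * e)) (by positivity), mul_assoc (ENNReal.ofReal c₁⁻¹),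
    mul_assoc (ENNReal.ofReal (c₂⁻¹ * _))]
  have hW2 := hW (1 + 2 * e)
  rw [add_sub_cancel_left, mul_div_cancel_left₀ _ two_ne_zero] at hW2
  gcongr
  exact hW p

/-! ### The bandwidth -/

/-- The width of the perturbation: the solution `h` of
`n A² h ^ (2β + 1 + p) = b ^ (1 - p) (ln n) ^ (q + κ)`. -/
noncomputable def bandwidth (β p q A b : ℝ) (n : ℕ) : ℝ :=
  (b ^ (1 - p) * Real.log n ^ (q + kappa p) / (n * A ^ 2)) ^ (1 / (2 * β + 1 + p))

theorem kappa_nonneg (p : ℝ) : 0 ≤ kappa p := by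
  unfold kappa; split_ifs <;> norm_num

theorem log_natCast_pos {n : ℕ} (hn : 2 ≤ n) : 0 < Real.log n :=
  Real.log_pos (by exact_mod_cast hn)

theorem bandwidth_base_pos {p q A b : ℝ} (hA : 0 < A) (hb : 0 < b) {n : ℕ} (hn : 2 ≤ n) :
    0 < b ^ (1 - p) * Real.log n ^ (q + kappa p) / (n * A ^ 2) := by
  have h1 := log_natCast_pos hn
  have h2 : (0 : ℝ) < n := by positivity
  positivity

theorem bandwidth_pos {β p q A b : ℝ} (hA : 0 < A) (hb : 0 < b) {n : ℕ} (hn : 2 ≤ n) :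
    0 < bandwidth β p q A b n :=
  Real.rpow_pos_of_pos (bandwidth_base_pos hA hb hn) _

theorem bandwidth_rpow {β p q A b : ℝ} (hβ : 0 < β) (hp : 0 ≤ p) (hA : 0 < A) (hb : 0 < b) {n : ℕ}
    (hn : 2 ≤ n) :
    n * A ^ 2 * bandwidth β p q A b n ^ (2 * β + 1 + p) =
      b ^ (1 - p) * Real.log n ^ (q + kappa p) := by
  have h0 := bandwidth_base_pos (p := p) (q := q) hA hb hn
  have hd : 2 * β + 1 + p ≠ 0 := by positivity
  have hn' : (0 : ℝ) < n := by positivity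
  rw [bandwidth, ← Real.rpow_mul h0.le, one_div_mul_cancel hd, Real.rpow_one]
  field_simp

theorem lowerRate_eq {β p q A b : ℝ} (hβ : 0 < β) (hp : 0 ≤ p) (hA : 0 < A) (hb : 0 < b) {n : ℕ}
    (hn : 2 ≤ n) : lowerRate β p q A b n = A * bandwidth β p q A b n ^ β := by
  have h1 := log_natCast_pos hn
  have hd : 0 < 2 * β + 1 + p := by positivity
  have hn' : (0 : ℝ) < n := by positivity
  have hA2 : A * ((A ^ 2) ^ (β / (2 * β + 1 + p)))⁻¹ = A ^ ((p + 1) / (2 * β + 1 + p)) := by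
    rw [← Real.rpow_natCast, ← Real.rpow_mul hA.le, ← Real.rpow_neg hA.le]
    nth_rewrite 1 [← Real.rpow_one A]
    rw [← Real.rpow_add hA]
    congr 1
    push_cast
    field_simp
    ring
  rw [lowerRate, bandwidth, ← Real.rpow_mul (bandwidth_base_pos hA hb hn).le, ← div_div,
    Real.div_rpow (y := A ^ 2) (by positivity) (by positivity), one_div_mul_eq_div, ← hA2]
  ring

theorem lowerRate_eq_mul {β p q A M b : ℝ} (hb : 0 < b) (hM : 0 < M) {n : ℕ} (hn : 2 ≤ n) :
    lowerRate β p q A M n =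
      (M / b) ^ ((1 - p) * (β / (2 * β + 1 + p))) * lowerRate β p q A b n := by
  have h1 := log_natCast_pos hn
  have h2 : M ^ (1 - p) * Real.log n ^ (q + kappa p) / n =
      (M / b) ^ (1 - p) * (b ^ (1 - p) * Real.log n ^ (q + kappa p) / n) := by
    rw [Real.div_rpow hM.le hb.le]
    have : b ^ (1 - p) ≠ 0 := by positivity
    field_simp
  rw [lowerRate, lowerRate, h2, Real.mul_rpow (by positivity) (by positivity),
    ← Real.rpow_mul (by positivity)]
  ring

theorem tendsto_log_rpow_mul_rpow_neg (r : ℝ) {s : ℝ} (hs : 0 < s) :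
    Tendsto (fun n : ℕ => Real.log n ^ r * (n : ℝ) ^ (-s)) atTop (nhds 0) := by
  have h := (isLittleO_log_rpow_rpow_atTop r hs).tendsto_div_nhds_zero
  refine (h.comp tendsto_natCast_atTop_atTop).congr fun n => ?_
  simp only [Function.comp_apply]
  rw [Real.rpow_neg n.cast_nonneg, div_eq_mul_inv]

/-- The bandwidth decreases at least as a power of the sample size, so that `ln (1 / h)` is at
least of the order of `ln n`. -/
theorem eventually_bandwidth_le {β p q A b : ℝ} (hβ : 0 < β) (hp : 0 ≤ p) (hA : 0 < A)
    (hb : 0 < b) :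
    ∀ᶠ n : ℕ in atTop, bandwidth β p q A b n ≤ (n : ℝ) ^ (-(1 / (2 * (2 * β + 1 + p)))) := by
  have h := (tendsto_log_rpow_mul_rpow_neg (q + kappa p) one_half_pos).const_mul
    (b ^ (1 - p) / A ^ 2)
  rw [mul_zero] at h
  filter_upwards [h.eventually_le_const one_pos, eventually_ge_atTop 2] with n hn hn2
  have hn' : (0 : ℝ) < n := by positivity
  have hd : 0 < 2 * β + 1 + p := by positivity
  have h1 : b ^ (1 - p) * Real.log n ^ (q + kappa p) / (n * A ^ 2) ≤ (n : ℝ) ^ (-(1 / 2) : ℝ) := by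
    calc _ = (b ^ (1 - p) / A ^ 2 * (Real.log n ^ (q + kappa p) * (n : ℝ) ^ (-(1 / 2) : ℝ))) *
          (n : ℝ) ^ (-(1 / 2) : ℝ) := by
          have : (n : ℝ)⁻¹ = (n : ℝ) ^ (-(1 / 2) : ℝ) * (n : ℝ) ^ (-(1 / 2) : ℝ) := by
            rw [← Real.rpow_add hn', ← Real.rpow_neg_one]; norm_num
          rw [div_eq_mul_inv, mul_inv, this]
          ring
      _ ≤ 1 * (n : ℝ) ^ (-(1 / 2) : ℝ) := by gcongr
      _ = _ := one_mul _
  calc bandwidth β p q A b n ≤ ((n : ℝ) ^ (-(1 / 2) : ℝ)) ^ (1 / (2 * β + 1 + p)) :=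
        Real.rpow_le_rpow (bandwidth_base_pos hA hb hn2).le h1 (by positivity)
    _ = _ := by
        rw [← Real.rpow_mul hn'.le]
        congr 1
        field_simp

theorem tendsto_bandwidth {β p q A b : ℝ} (hβ : 0 < β) (hp : 0 ≤ p) (hA : 0 < A) (hb : 0 < b) :
    Tendsto (bandwidth β p q A b) atTop (nhds 0) := by
  have hs : 0 < 1 / (2 * (2 * β + 1 + p)) := by positivity
  refine tendsto_of_tendsto_of_tendsto_of_le_of_le' tendsto_const_nhds
    ((tendsto_rpow_neg_atTop hs).comp tendsto_natCast_atTop_atTop) ?_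
    (eventually_bandwidth_le hβ hp hA hb)
  filter_upwards [eventually_ge_atTop 2] with n hn using (bandwidth_pos hA hb hn).le

theorem tendsto_log_rpow_mul_bandwidth_rpow {β p q A b s : ℝ} (hβ : 0 < β) (hp : 0 ≤ p)
    (hA : 0 < A) (hb : 0 < b) (r : ℝ) (hs : 0 < s) :
    Tendsto (fun n : ℕ => Real.log n ^ r * bandwidth β p q A b n ^ s) atTop (nhds 0) := by
  have hs' : 0 < 1 / (2 * (2 * β + 1 + p)) * s := by positivity
  refine tendsto_of_tendsto_of_tendsto_of_le_of_le' tendsto_const_nhds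
    (tendsto_log_rpow_mul_rpow_neg r hs') ?_ ?_
  · filter_upwards [eventually_ge_atTop 2] with n hn
    have := log_natCast_pos hn
    have := bandwidth_pos (β := β) (p := p) (q := q) hA hb hn
    positivity
  · filter_upwards [eventually_bandwidth_le (q := q) hβ hp hA hb, eventually_ge_atTop 2]
      with n hn hn2
    have h1 := log_natCast_pos hn2
    have h2 := bandwidth_pos (β := β) (p := p) (q := q) hA hb hn2
    gcongr
    calc _ ≤ ((n : ℝ) ^ (-(1 / (2 * (2 * β + 1 + p))))) ^ s := by gcongr
      _ = _ := by rw [← Real.rpow_mul n.cast_nonneg, neg_mul]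

/-! ### The lower bound -/

theorem le_minimaxRisk_of_likelihoodRatio {f₀ f₁ g : ℝ → ℝ} {S : Set (ℝ → ℝ)} (hf₀ : f₀ ∈ S)
    (hf₁ : f₁ ∈ S) (hd₀ : IsNonnegDensity f₀) (hd₁ : IsNonnegDensity f₁) (hg : IsNonnegDensity g)
    {n : ℕ} {L : ℝ → ENNReal} (hL : Measurable L) (hlaw : obsLaw f₁ g = (obsLaw f₀ g).withDensity L)
    (hL2 : (∫⁻ y, L y ^ 2 ∂(obsLaw f₀ g)) ^ n ≤ 4) :
    ENNReal.ofReal (|f₁ 0 - f₀ 0| / 3) ≤ minimaxRisk g S n := by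
  refine le_iInf₂ fun T hT => ?_
  set R := ⨆ f ∈ S, rmsRisk g n T f with hR
  have h0 : rmsRisk g n T f₀ ≤ R := le_iSup₂ (f := fun f _ => rmsRisk g n T f) f₀ hf₀
  have h1 : rmsRisk g n T f₁ ≤ R := le_iSup₂ (f := fun f _ => rmsRisk g n T f) f₁ hf₁
  have := isProbabilityMeasure_obsLaw hd₀ hg
  have : IsProbabilityMeasure ((obsLaw f₀ g).withDensity L) :=
    hlaw ▸ isProbabilityMeasure_obsLaw hd₁ hg
  have h := abs_sub_le_rms_add_rms n (obsLaw f₀ g) hL hT (f₀ 0) (f₁ 0)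
  rw [← hlaw] at h
  have h2 : ((∫⁻ y, L y ^ 2 ∂(obsLaw f₀ g)) ^ n) ^ (1 / 2 : ℝ) ≤ 2 := by
    calc _ ≤ (4 : ENNReal) ^ (1 / 2 : ℝ) := by gcongr
      _ = 2 := by
        rw [show (4 : ENNReal) = 2 ^ (2 : ℝ) by norm_num, ← ENNReal.rpow_mul]
        norm_num
  rw [ENNReal.ofReal_div_of_pos (by norm_num)]
  refine ENNReal.div_le_of_le_mul (h.trans ?_)
  calc rmsRisk g n T f₁ + rmsRisk g n T f₀ *
        ((∫⁻ y, L y ^ 2 ∂(obsLaw f₀ g)) ^ n) ^ (1 / 2 : ℝ) ≤ R + R * 2 := by gcongr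
    _ = R * ENNReal.ofReal 3 := by
      rw [show ENNReal.ofReal 3 = 3 by simp, show (3 : ENNReal) = 1 + 2 by norm_num]
      ring

theorem one_add_pow_le_four {n : ℕ} (hn : 0 < n) {x : ENNReal} (hx : n * x ≤ 1) :
    (1 + x) ^ n ≤ 4 := by
  have hn' : (0 : ℝ) < n := by positivity
  have hx' : x ≤ ENNReal.ofReal (1 / n) := by
    rw [one_div, ENNReal.ofReal_inv_of_pos hn', ENNReal.ofReal_natCast,
      ENNReal.le_inv_iff_mul_le, mul_comm]
    exact hx
  calc (1 + x) ^ n ≤ (ENNReal.ofReal 1 + ENNReal.ofReal (1 / n)) ^ n := by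
        rw [ENNReal.ofReal_one]; gcongr
    _ = ENNReal.ofReal ((1 + 1 / n) ^ n) := by
        rw [← ENNReal.ofReal_add zero_le_one (by positivity), ENNReal.ofReal_pow (by positivity)]
    _ ≤ ENNReal.ofReal 4 := by
        refine ENNReal.ofReal_le_ofReal ?_
        calc ((1 : ℝ) + 1 / n) ^ n ≤ Real.exp (1 / n) ^ n := by
              gcongr
              rw [add_comm]
              exact Real.add_one_le_exp _
          _ = Real.exp 1 := by rw [← Real.exp_nat_mul]; congr 1; field_simp
          _ ≤ 4 := by linarith [Real.exp_one_lt_d9]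
    _ = 4 := by simp

/-- The lower bound near the origin, in the form in which it is used: for observations up to
`h ^ ρ`, where `h` decreases at least as a power of the sample size, the logarithm of `1 / (b y)`
is at least of the order of `ln n`. -/
theorem le_obsDensity_lomaxDensity_of_le_rpow {p q δ c₀ C₀ a b h ρ γ y : ℝ} {g : ℝ → ℝ} {n : ℕ}
    (hp : 0 ≤ p) (hp1 : p < 1) (hq : 0 ≤ q) (hδ : 0 < δ) (hc₀ : 0 < c₀) (ha : 0 < a) (ha1 : a ≤ 1)
    (hb : 0 < b) (hnz : NearZeroCondition p q δ c₀ C₀ g) (hn : 2 ≤ n) (hh0 : 0 < h) (hρ0 : 0 < ρ)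
    (hγ : 0 < γ) (hhn : h ≤ (n : ℝ) ^ (-γ)) (hy4 : b * h ^ ρ ≤ 1 / 4) (hyδ : b * h ^ ρ < δ ^ 2)
    (hhb : b * h ^ (ρ / 2) ≤ 1) (hy : 0 < y) (hyy : y ≤ h ^ ρ) :
    ENNReal.ofReal (a * c₀ / 16 * (1 / 2 * (ρ / 2 * γ)) ^ (q + kappa p) * b ^ (1 - p) *
        Real.log n ^ (q + kappa p) * y ^ (-p)) ≤
      obsDensity (lomaxDensity a b) g y := by
  have hn' : (0 : ℝ) < n := by positivity
  have hlog := log_natCast_pos hn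
  set σ := 1 / 2 * (ρ / 2 * γ) with hσ
  have hσ0 : 0 < σ := by positivity
  have hby : b * y ≤ b * h ^ ρ := by gcongr
  refine le_trans (ENNReal.ofReal_le_ofReal ?_)
    (le_obsDensity_lomaxDensity_of_small hp hp1 hq hδ hc₀ ha ha1 hb hnz hy (hby.trans hy4)
      (hby.trans_lt hyδ))
  have hlogy : σ * Real.log n ≤ 1 / 2 * Real.log (1 / (b * y)) := by
    have h1 : b * y ≤ h ^ (ρ / 2) := by
      calc b * y ≤ b * h ^ ρ := hby
        _ = (b * h ^ (ρ / 2)) * h ^ (ρ / 2) := by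
          rw [mul_assoc, ← Real.rpow_add hh0, add_halves]
        _ ≤ 1 * h ^ (ρ / 2) := by gcongr
        _ = _ := one_mul _
    have h2 : Real.log (b * y) ≤ ρ / 2 * Real.log h := by
      rw [← Real.log_rpow hh0]
      exact Real.log_le_log (by positivity) h1
    have h3 : Real.log h ≤ -γ * Real.log n := by
      rw [← Real.log_rpow hn']
      exact Real.log_le_log hh0 hhn
    have h4 := mul_le_mul_of_nonneg_left h3 (half_pos hρ0).le
    rw [one_div (b * y), Real.log_inv, hσ]
    linarith
  have hk : 0 ≤ q + kappa p := add_nonneg hq (kappa_nonneg p)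
  calc _ = a * b * c₀ / 16 * (b * y) ^ (-p) * (σ * Real.log n) ^ (q + kappa p) := by
        rw [Real.mul_rpow hσ0.le hlog.le, Real.mul_rpow hb.le hy.le, sub_eq_add_neg,
          Real.rpow_add hb, Real.rpow_one]
        ring
    _ ≤ _ := by gcongr

/-- With the bandwidth chosen such that `n A² h ^ (2β + 1 + p)` equals `B l`, the `n`-fold excess
second moment of the likelihood ratio is at most one.  Here `G` and `G₂` are the factors in the
contributions of the small and the large observations; the second contribution vanishes
asymptotically. -/
theorem natCast_mul_excess_le_one {g : ℝ → ℝ} (hg : IsNonnegDensity g) {k : ℝ → ENNReal} {n : ℕ}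
    {β p e A B c c₂ w l h G G₂ : ℝ} (he : 0 < e) (hB : 0 < B) (hc₂ : 0 < c₂)
    (hw : 0 < w) (hl : 0 < l) (hh0 : 0 < h) (hh1 : h ≤ 1) (hG0 : 0 ≤ G) (hG₂0 : 0 ≤ G₂)
    (hG : posMoment g ((p - 1) / 2) ^ 2 *
      ∫⁻ z in Ioi 0, ENNReal.ofReal (z ^ p * Real.exp (-(2 * z))) ≤ ENNReal.ofReal G)
    (hG₂ : posMoment g e ^ 2 *
      ∫⁻ z in Ioi 0, ENNReal.ofReal (z ^ (1 + 2 * e) * Real.exp (-(2 * z))) ≤ ENNReal.ofReal G₂)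
    (hsmall : ∀ y, 0 < y → y ≤ h ^ (2 * e / (1 + 2 * e)) →
      ENNReal.ofReal (w * B * l * y ^ (-p)) ≤ k y)
    (hglob : ∀ y, 0 < y → ENNReal.ofReal (c₂ * (max 1 y) ^ (-1 - e)) ≤ k y)
    (heq : n * A ^ 2 * h ^ (2 * β + 1 + p) = B * l) (hcG : c ^ 2 * (w⁻¹ * G) ≤ 1 / 2)
    (hrem : c ^ 2 * (c₂⁻¹ * G₂) * B * (l * h ^ (1 - p)) ≤ 1 / 2) :
    n * (ENNReal.ofReal ((c * A * h ^ (β + 1)) ^ 2) *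
      ∫⁻ y in Ioi 0, obsDensity (expDensity h) g y ^ 2 / k y) ≤ 1 := by
  set ρ := 2 * e / (1 + 2 * e) with hρ
  have hρ0 : 0 < ρ := by positivity
  have hn0 : (0 : ℝ) ≤ n := n.cast_nonneg
  set τ := c * A * h ^ (β + 1) with hτ
  have hχ := lintegral_obsDensity_expDensity_sq_div_le hg (p := p) he (by positivity) hc₂ hh0
    (by positivity) (Real.rpow_le_one hh0.le hh1 hρ0.le) hsmall hglob
  have hτ2 : n * τ ^ 2 * h ^ (p - 1) = c ^ 2 * (B * l) := by
    rw [← heq, hτ, mul_pow, mul_pow, ← Real.rpow_natCast (h ^ (β + 1)), ← Real.rpow_mul hh0.le,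
      show 2 * β + 1 + p = (β + 1) * (2 : ℕ) + (p - 1) by push_cast; ring, Real.rpow_add hh0]
    ring
  have hτ2' : n * τ ^ 2 = c ^ 2 * (B * l) * h ^ (1 - p) := by
    rw [← hτ2, mul_assoc, ← Real.rpow_add hh0]
    simp
  have hfar : (h ^ ρ) ^ (-(1 + 2 * e)) * h ^ (2 * e) = 1 := by
    rw [← Real.rpow_mul hh0.le, ← Real.rpow_add hh0, hρ]
    have : 2 * e / (1 + 2 * e) * -(1 + 2 * e) + 2 * e = 0 := by field_simp; ring
    rw [this, Real.rpow_zero]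
  calc _ ≤ n * (ENNReal.ofReal (τ ^ 2) *
        (ENNReal.ofReal ((w * B * l)⁻¹ * h ^ (p - 1)) * ENNReal.ofReal G +
          ENNReal.ofReal (c₂⁻¹ * (h ^ ρ) ^ (-(1 + 2 * e)) * h ^ (2 * e)) *
            ENNReal.ofReal G₂)) := by
        gcongr
        refine hχ.trans ?_
        gcongr
    _ = ENNReal.ofReal (n * (τ ^ 2 * ((w * B * l)⁻¹ * h ^ (p - 1) * G +
          c₂⁻¹ * (h ^ ρ) ^ (-(1 + 2 * e)) * h ^ (2 * e) * G₂))) := by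
        rw [ENNReal.ofReal_mul hn0, ENNReal.ofReal_mul (sq_nonneg τ),
          ENNReal.ofReal_add (by positivity) (by positivity),
          ENNReal.ofReal_mul' hG0, ENNReal.ofReal_mul' hG₂0, ENNReal.ofReal_natCast]
    _ ≤ ENNReal.ofReal 1 := by
        refine ENNReal.ofReal_le_ofReal ?_
        calc _ = (n * τ ^ 2 * h ^ (p - 1)) * (w * B * l)⁻¹ * G +
              c₂⁻¹ * ((h ^ ρ) ^ (-(1 + 2 * e)) * h ^ (2 * e)) * G₂ * (n * τ ^ 2) := by ring
          _ = c ^ 2 * (w⁻¹ * G) + c ^ 2 * (c₂⁻¹ * G₂) * B * (l * h ^ (1 - p)) := by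
            rw [hτ2, hτ2', hfar]
            field_simp
          _ ≤ 1 := by linarith
    _ = 1 := ENNReal.ofReal_one

/-- The two-point lower bound.  The constant depends on neither `g` nor on the scale `b` of the
unperturbed density, which enters the rate in the place of `M`. -/
theorem exists_eventually_le_minimaxRisk (β p q δ c₀ C₀ e : ℝ) (hβ : 0 < β) (hp : 0 ≤ p)
    (hp1 : p < 1) (hq : 0 ≤ q) (hδ : 0 < δ) (hδ1 : δ < 1) (hc₀ : 0 < c₀) (he : 0 < e)
    (he1 : e ≤ 1) :
    ∃ C : ℝ, 0 < C ∧ ∀ g : ℝ → ℝ, IsNonnegDensity g → NearZeroCondition p q δ c₀ C₀ g →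
      posMoment g e ≠ ⊤ → ∀ r A M b : ℝ, 0 < A → 0 < b → b ≤ M / 2 →
      (∀ k : ℕ, 1 ≤ k → k ≤ holderOrder β → b ^ (k + 1) * (k + 1).factorial ≤ A / 2) →
      2 * b ^ (β + 1) * (holderOrder β + 2).factorial ≤ A / 2 →
      ∀ᶠ n : ℕ in atTop, ENNReal.ofReal (C * lowerRate β p q A b n) ≤
        minimaxRisk g {f | HolderClass r A β M f} n := by
  obtain ⟨m, hm, hmle⟩ := exists_posMoment_le p q δ C₀ hp1 hq hδ hδ1
  have hd : 0 < 2 * β + 1 + p := by positivity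
  have hp1' : 0 < 1 - p := by linarith
  -- The small and the large values of an observation are separated by `h ^ ρ`; this exponent
  -- makes the contribution of the large values to the second moment bounded.
  set ρ := 2 * e / (1 + 2 * e) with hρ
  have hρ0 : 0 < ρ := by positivity
  -- `ln (1 / (b y)) / 2` will be at least `σ ln n` for the small values `y`.
  set σ := 1 / 2 * (ρ / 2 * (1 / (2 * (2 * β + 1 + p)))) with hσ
  have hσ0 : 0 < σ := by positivity
  set w := e * c₀ / 16 * σ ^ (q + kappa p) with hw
  have hw0 : 0 < w := by positivity
  set G := (m ^ 2 * ∫⁻ z in Ioi 0, ENNReal.ofReal (z ^ p * Real.exp (-(2 * z)))).toReal with hG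
  have hG0 : 0 ≤ G := ENNReal.toReal_nonneg
  have hGtop : m ^ 2 * ∫⁻ z in Ioi 0, ENNReal.ofReal (z ^ p * Real.exp (-(2 * z))) =
      ENNReal.ofReal G := by
    rw [hG, ENNReal.ofReal_toReal]
    exact ENNReal.mul_ne_top (ENNReal.pow_ne_top hm) (lintegral_rpow_mul_exp_ne_top (by linarith))
  -- The amplitude `c` is small enough both for the Hölder class and for the leading term of the
  -- second moment of the likelihood ratio.
  set c := 1 / (4 * (1 + w⁻¹ * G)) with hc
  have hwG : 0 ≤ w⁻¹ * G := by positivity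
  have hc0 : 0 < c := by positivity
  have hc1 : c ≤ 1 / 4 := by
    rw [hc]
    exact one_div_le_one_div_of_le (by norm_num) (by linarith)
  have hcG : c ^ 2 * (w⁻¹ * G) ≤ 1 / 2 := by
    have h1 : c * (w⁻¹ * G) ≤ 1 / 4 := by
      rw [hc, one_div_mul_eq_div, div_le_div_iff₀ (by positivity) (by norm_num)]
      linarith
    calc c ^ 2 * (w⁻¹ * G) = c * (c * (w⁻¹ * G)) := by ring
      _ ≤ 1 / 4 * (1 / 4) := by gcongr
      _ ≤ 1 / 2 := by norm_num
  refine ⟨c / 6, by positivity, fun g hg hnz hge r A M b hA hb hbM hbA hbA' => ?_⟩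
  obtain ⟨c₂, hc₂, hglob⟩ := exists_le_obsDensity_lomaxDensity (a := e) hp hq hδ hδ1 hc₀ he hb hnz
  set G₂ := (posMoment g e ^ 2 *
    ∫⁻ z in Ioi 0, ENNReal.ofReal (z ^ (1 + 2 * e) * Real.exp (-(2 * z)))).toReal with hG₂
  have hG₂0 : 0 ≤ G₂ := ENNReal.toReal_nonneg
  have hG₂top : posMoment g e ^ 2 *
      ∫⁻ z in Ioi 0, ENNReal.ofReal (z ^ (1 + 2 * e) * Real.exp (-(2 * z))) =
      ENNReal.ofReal G₂ := by
    rw [hG₂, ENNReal.ofReal_toReal]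
    exact ENNReal.mul_ne_top (ENNReal.pow_ne_top hge) (lintegral_rpow_mul_exp_ne_top (by linarith))
  have hM : 0 < M := by linarith
  have hh := tendsto_bandwidth (q := q) hβ hp hA hb
  have hpow : ∀ {s : ℝ}, 0 < s → ∀ k : ℝ,
      Tendsto (fun n => k * bandwidth β p q A b n ^ s) atTop (nhds 0) := by
    intro s hs k
    have := (hh.rpow_const (Or.inr hs.le)).const_mul k
    rwa [Real.zero_rpow hs.ne', mul_zero] at this
  have hrem := (tendsto_log_rpow_mul_bandwidth_rpow (q := q) hβ hp hA hb (q + kappa p) hp1').const_mul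
    (c ^ 2 * (c₂⁻¹ * G₂) * b ^ (1 - p))
  rw [mul_zero] at hrem
  filter_upwards [eventually_ge_atTop 2, hh.eventually_le_const one_pos,
    (hh.const_mul (e * b)).eventually_le_const (show e * b * 0 < 1 / 2 by norm_num),
    (hpow (show 0 < β + 1 by linarith) (c * A)).eventually_le_const one_pos,
    (hpow hβ (c * A)).eventually_le_const (half_pos hM),
    (hpow hρ0 b).eventually_le_const (show (0 : ℝ) < 1 / 4 by norm_num),
    (hpow hρ0 b).eventually_lt_const (show 0 < δ ^ 2 by positivity),
    (hpow (half_pos hρ0) b).eventually_le_const one_pos,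
    eventually_bandwidth_le (q := q) hβ hp hA hb,
    hrem.eventually_le_const (show (0 : ℝ) < 1 / 2 by norm_num)]
    with n hn hh1 hebh hτ1 hhM hy4 hyδ hhb hhn hrem'
  have hn' : (0 : ℝ) < n := by positivity
  have hlog := log_natCast_pos hn
  have hh0 := bandwidth_pos (β := β) (p := p) (q := q) hA hb hn
  have heq := bandwidth_rpow (q := q) hβ hp hA hb hn
  rw [lowerRate_eq hβ hp hA hb hn]
  set h := bandwidth β p q A b n with hhdef
  set l := Real.log n ^ (q + kappa p) with hl
  have hl0 : 0 < l := by positivity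
  set τ := c * A * h ^ (β + 1) with hτ
  have hτ0 : 0 ≤ τ := by positivity
  have hbp : 0 < b ^ (1 - p) := by positivity
  have hbase : hypDensity β A e b 0 h = lomaxDensity e b := by
    funext x; simp [hypDensity]
  have hd₀ := isNonnegDensity_lomaxDensity he hb
  have hdh := isNonnegDensity_expDensity hh0
  have hmem₀ : HolderClass r A β M (lomaxDensity e b) := by
    rw [← hbase]
    refine holderClass_hypDensity hβ he he1 hb hA hh0 hh1 le_rfl (by norm_num) ?_ hbM ?_ hbA hbA'
    · simp
    · simpa using (half_pos hM).le
  have hmem₁ : HolderClass r A β M (hypDensity β A e b c h) :=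
    holderClass_hypDensity hβ he he1 hb hA hh0 hh1 hc0.le hc1 hτ1 hbM hhM hbA hbA'
  have hpos : ∀ y, 0 < y → obsDensity (lomaxDensity e b) g y ≠ 0 := by
    intro y hy
    have hm' : 0 < max 1 y := lt_max_of_lt_left one_pos
    refine ((ENNReal.ofReal_pos.2 ?_).trans_le (hglob y hy)).ne'
    positivity
  obtain ⟨L, hL, hlaw, hL2⟩ := exists_likelihoodRatio_mixture hd₀ hdh hg hτ0 hτ1 hpos
  have hχ := natCast_mul_excess_le_one hg (β := β) (p := p) he hbp hc₂ hw0 hl0 hh0 hh1 hG0 hG₂0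
    (hGtop ▸ by gcongr; exact hmle g c₀ hg hnz) hG₂top.le
    (fun y hy hyy => le_obsDensity_lomaxDensity_of_le_rpow hp hp1 hq hδ hc₀ he he1 hb hnz hn hh0 hρ0
      (by positivity) hhn hy4 hyδ hhb hy hyy) hglob heq hcG hrem'
  have hmain := le_minimaxRisk_of_likelihoodRatio (S := {f | HolderClass r A β M f}) hmem₀ hmem₁ hd₀
    hmem₁.density hg hL hlaw (n := n)
    ((pow_le_pow_left' hL2 n).trans (one_add_pow_le_four (by omega) hχ))
  refine le_trans (ENNReal.ofReal_le_ofReal ?_) hmain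
  rw [← hbase, hypDensity_zero_sub hh0]
  have h5 : (1 / 2 : ℝ) ≤ 1 - e * b * h := by linarith
  have h6 : 0 < c * A * h ^ β := by positivity
  have h7 := mul_le_mul_of_nonneg_left h5 h6.le
  rw [abs_of_nonneg (mul_nonneg h6.le (by linarith))]
  linarith

/-- The rates for two bounds `b` and `M` of the densities differ by a constant factor only. -/
theorem le_normalizedRiskLiminf {g : ℝ → ℝ} {β p q r A M b C : ℝ} (hA : 0 < A)
    (hb : 0 < b) (hM : 0 < M) (hC : 0 < C)
    (h : ∀ᶠ n : ℕ in atTop, ENNReal.ofReal (C * lowerRate β p q A b n) ≤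
      minimaxRisk g {f | HolderClass r A β M f} n) :
    ENNReal.ofReal (C * (b / M) ^ ((1 - p) * (β / (2 * β + 1 + p)))) ≤
      normalizedRiskLiminf g β p q r A M := by
  refine le_liminf_of_le (by isBoundedDefault) ?_
  filter_upwards [h, eventually_ge_atTop 2] with n hn hn2
  have hpos : 0 < lowerRate β p q A M n := by
    have h1 := log_natCast_pos hn2
    have h2 : (0 : ℝ) < n := by positivity
    unfold lowerRate
    positivity
  rw [ENNReal.le_div_iff_mul_le (Or.inl (ENNReal.ofReal_pos.2 hpos).ne')
    (Or.inl ENNReal.ofReal_ne_top), ← ENNReal.ofReal_mul (by positivity)]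
  refine le_trans (le_of_eq ?_) hn
  rw [lowerRate_eq_mul hb hM hn2, ← inv_div M b, Real.inv_rpow (by positivity)]
  have : (M / b) ^ ((1 - p) * (β / (2 * β + 1 + p))) ≠ 0 := by positivity
  field_simp

theorem mainTheorem6 (β : ℝ) (hβ : 0 < β) :
    ∃ K : ℝ, 0 < K ∧
      ∀ p q δ c₀ C₀ ε C₄ : ℝ,
        0 ≤ p → p < 1 → 0 ≤ q → 0 < δ → δ < 1 → 0 < c₀ → 0 < ε →
        (∃ C₅ : ℝ, 0 < C₅ ∧
          ∀ g : ℝ → ℝ, IsNonnegDensity g → NearZeroCondition p q δ c₀ C₀ g →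
            MellinStripCondition ε C₄ g →
            ∀ r A M : ℝ, 0 < r → 0 < A → 1 ≤ M → K * M ^ (β + 1) ≤ A →
              ENNReal.ofReal C₅ ≤ normalizedRiskLiminf g β p q r A M) ∧
        (∀ r A M : ℝ, 0 < r → 0 < A → 1 ≤ M →
          ∃ C : ℝ, 0 < C ∧
            ∀ g : ℝ → ℝ, IsNonnegDensity g → NearZeroCondition p q δ c₀ C₀ g →
              MellinStripCondition ε C₄ g →
                ENNReal.ofReal C ≤ normalizedRiskLiminf g β p q r A M) := by
  set ℓ := holderOrder β with hℓ
  have hℓβ : (ℓ : ℝ) < β := (isGreatest_holderOrder hβ).1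
  set N : ℝ := ((ℓ + 2).factorial : ℝ) with hN
  have hN0 : 0 < N := by positivity
  have hfac : ∀ k : ℕ, k ≤ ℓ → (((k + 1).factorial : ℕ) : ℝ) ≤ N := fun k hk => by
    rw [hN]; exact_mod_cast Nat.factorial_le (by omega)
  refine ⟨4 * N, by positivity, fun p q δ c₀ C₀ ε C₄ hp hp1 hq hδ hδ1 hc₀ hε => ?_⟩
  have he : 0 < min ε 1 := lt_min hε one_pos
  obtain ⟨C, hC, hmain⟩ := exists_eventually_le_minimaxRisk β p q δ c₀ C₀ (min ε 1) hβ hp hp1 hq hδ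
    hδ1 hc₀ he (min_le_right _ _)
  have hmom : ∀ g, IsNonnegDensity g → MellinStripCondition ε C₄ g →
      posMoment g (min ε 1) ≠ ⊤ := fun g hg hS => by
    refine posMoment_ne_top_of_mellinConvergent hg.nonneg (hS.1 _ ?_ ?_)
    · simp [hε.le]
    · simp
  refine ⟨⟨C * (1 / 2) ^ ((1 - p) * (β / (2 * β + 1 + p))), by positivity, ?_⟩, ?_⟩
  · intro g hg hnz hS r A M _ hA hM hAM
    have hM0 : 0 < M := by linarith
    have hb : 0 < M / 2 := by positivity
    have hbM : M / 2 ≤ M := by linarith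
    have h := le_normalizedRiskLiminf hA hb hM0 hC
      (hmain g hg hnz (hmom g hg hS) r A M (M / 2) hA hb le_rfl (fun k _ hk => ?_) ?_)
    · rwa [show M / 2 / M = 1 / 2 by field_simp] at h
    · have h1 : (M / 2) ^ (k + 1) ≤ M ^ (β + 1) := by
        calc (M / 2) ^ (k + 1) ≤ M ^ (k + 1) := by gcongr
          _ = M ^ ((k + 1 : ℕ) : ℝ) := (Real.rpow_natCast _ _).symm
          _ ≤ M ^ (β + 1) := by
            refine Real.rpow_le_rpow_of_exponent_le hM ?_
            have : (k : ℝ) ≤ ℓ := by exact_mod_cast hk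
            push_cast
            linarith
      calc (M / 2) ^ (k + 1) * (k + 1).factorial ≤ M ^ (β + 1) * N := by
            gcongr; exact hfac k hk
        _ ≤ A / 2 := by nlinarith [Real.rpow_pos_of_pos hM0 (β + 1)]
    · have h1 : (M / 2) ^ (β + 1) ≤ M ^ (β + 1) := by gcongr
      calc 2 * (M / 2) ^ (β + 1) * N ≤ 2 * M ^ (β + 1) * N := by gcongr
        _ ≤ A / 2 := by linarith
  · intro r A M _ hA hM
    have hM0 : 0 < M := by linarith
    obtain ⟨b, hb, hbM, hb1, hbA⟩ : ∃ b, 0 < b ∧ b ≤ M / 2 ∧ b ≤ 1 ∧ b ≤ A / (4 * N) :=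
      ⟨min (M / 2) (min 1 (A / (4 * N))), by positivity, min_le_left _ _,
        (min_le_right _ _).trans (min_le_left _ _), (min_le_right _ _).trans (min_le_right _ _)⟩
    have hbN : 4 * b * N ≤ A := by
      rw [le_div_iff₀ (by positivity)] at hbA
      linarith
    refine ⟨C * (b / M) ^ ((1 - p) * (β / (2 * β + 1 + p))), by positivity,
      fun g hg hnz hS => le_normalizedRiskLiminf hA hb hM0 hC
        (hmain g hg hnz (hmom g hg hS) r A M b hA hb hbM (fun k _ hk => ?_) ?_)⟩
    · have h1 : b ^ (k + 1) ≤ b := pow_le_of_le_one hb.le hb1 (by omega)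
      calc b ^ (k + 1) * (k + 1).factorial ≤ b * N := by
            gcongr; exact hfac k hk
        _ ≤ A / 2 := by nlinarith
    · have h1 : b ^ (β + 1) ≤ b := by
        simpa using Real.rpow_le_rpow_of_exponent_ge hb hb1 (show 1 ≤ β + 1 by linarith)
      calc 2 * b ^ (β + 1) * N ≤ 2 * b * N := by gcongr
        _ ≤ A / 2 := by linarith
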